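/- Conventions. $K$ is an abelian group. For a $K$-graded ring $T$ let $T^+$ be the set of non-zero homogeneous elements and $\deg_K(T^+)\subseteq K$ the set of their degrees. $T$ is $K$-simple if $T\neq 0$ and every element of $T^+$ is invertible. A discrete $K$-valuation on a $K$-simple ring $S$ is a surjective homomorphism $\nu:S^+\to\mathbb Z$ with $\nu(a+b)\ge\min\{\nu(a),\nu(b)\}$ for $a,b\in S^+$ of the same degree with $a+b\ne 0$; its valuation ring $S_\nu$ is the subring generated by $\{a\in S^+:\nu(a)\ge 0\}$. A family $\{\nu_j\}$ of discrete $K$-valuations on $S$ defines $R\subseteq S$ if $R=\bigcap_j S_{\nu_j}$ and, for each $a\in R^+$, only finitely many $\nu_j(a)$ are non-zero. A Krull ring is an integral domain that is defined in its field of fractions by such a family (for $K=0$). Let $R$ be a graded ring with homogeneous fraction ring $Q^+(R)=(R^+)^{-1}R$, and for graded $R$-submodules of $Q^+(R)$ put $[\mathfrak a:\mathfrak b]=\{f:f\mathfrak b\subseteq\mathfrak a\}$. $\mathrm{Div}^K(R)$ is the set of non-zero graded $R$-submodules $\mathfrak a\subseteq Q^+(R)$ with $[R:\mathfrak a]\ne0$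 and $[R:[R:\mathfrak a]]=\mathfrak a$, with the addition $\mathfrak a+\mathfrak b=[R:[R:\mathfrak a\mathfrak b]]$, ordered by $\mathfrak a\le\mathfrak b\Leftrightarrow\mathfrak a\supseteq\mathfrak b$. Put $\mathrm{div}^K(f)=Rf$ for $f\in Q^+(R)^+$, and let $\mathrm{Cl}_K(R)$ be the cokernel of $\mathrm{div}^K$. For a $K$-valuation $\nu$ that is non-negative on $R^+$ put $\nu(\mathfrak a)=\max\{-\nu(f):f\in[R:\mathfrak a]\cap Q^+(R)^+\}$. A proper graded ideal is $K$-prime if it satisfies the condition of a prime ideal on homogeneous elements; the $K$-prime divisors are the minimal non-zero $K$-prime ideals $\mathfrak q$, and $R_{\mathfrak q}$ is the localization of $R$ by $R^+\setminus\mathfrak q$. For $K=0$ one obtains the divisors $\mathrm{Div}(A)$, the class group $\mathrm{Cl}(A)$ and the prime divisors $\mathfrak p$ of a Krull ring $A$; the essential valuation $\nu_{\mathfrak p}$ of $A$ is the discrete valuation of $Q(A)$ with valuation ring $A_{\mathfrak p}$. Theorem. Let $A$ be a Krull ring with field of fractions $Q(A)$, let $\varphi:K\to\mathrm{Div}(A)$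 be a homomorphism, and let $Q(A)[K]=\bigoplus_{w\in K}Q(A)\chi^w$ be the $K$-graded group algebra. For each prime divisor $\mathfrak p$ of $A$ set $\mu_{\mathfrak p}(a\chi^w)=\nu_{\mathfrak p}(a)+\nu_{\mathfrak p}(\varphi(w))$ for $a\in Q(A)^*$, $w\in K$, and let $R=\bigcap_{\mathfrak p}Q(A)[K]_{\mu_{\mathfrak p}}$, with the grading inherited from $Q(A)[K]$. Then: (i) $R_0=A$, and the inclusion $R\subseteq Q(A)[K]$ induces an isomorphism $Q^+(R)\cong Q(A)[K]$. (ii) $\{\mu_{\mathfrak p}\}_{\mathfrak p}$ are the essential $K$-valuations of $R$: they are discrete $K$-valuations that define $R$ in $Q(A)[K]$, and every family of discrete $K$-valuations that defines $R$ in $Q(A)[K]$ contains all of them. There is an isomorphism of ordered groups $$\alpha:\mathrm{Div}^K(R)\to\mathrm{Div}(A),\quad \mathfrak b\mapsto\sum_{\mathfrak p}\mu_{\mathfrak p}(\mathfrak b)\,\mathfrak p,\qquad\text{with inverse}\quad \mathfrak a\mapsto[R:[R:R\mathfrak a]],$$ where the sums are finite. ($K$-)prime divisors are ($K$-)divisors,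 and $\alpha$ restricts to a bijection from the $K$-prime divisors of $R$ to the prime divisors of $A$, given by $\mathfrak q\mapsto\mathfrak q\cap A$, with inverse $\mathfrak p\mapsto\langle\mu_{\mathfrak p}^{-1}(\mathbb Z_{>0})\cap R\rangle$. If $\mathfrak p=\mathfrak q\cap A$, then $\mu_{\mathfrak p}$ is the essential $K$-valuation at $\mathfrak q$: its valuation ring is $R_{\mathfrak q}$, and $\mu_{\mathfrak p}(f)$ is the coefficient of $\mathfrak q$ in $\mathrm{div}^K(f)=\sum_{\mathfrak q}\mu_{\mathfrak q\cap A}(f)\,\mathfrak q$ (a finite sum) for all $f\in Q(A)[K]^+$. Moreover $\alpha$ induces an isomorphism $\mathrm{Cl}_K(R)\cong\mathrm{Cl}(A)/\mathrm{im}(\bar\varphi)$, where $\bar\varphi:K\to\mathrm{Cl}(A)$ is the map induced by $\varphi$. (iii) For each $K$-prime divisor $\mathfrak q$ of $R$, the localization $R_{\mathfrak q}$ has units in every degree $w\in K$, and $(R_{\mathfrak q})_0=A_{\mathfrak p}$ where $\mathfrak p=\mathfrak q\cap A$. (iv) $\deg_K(R^+)=K$. -/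

import Mathlib

open scoped DirectSum

noncomputable section

namespace KKrull

/-! ### Graded rings and discrete `K`-valuations -/

section Graded

variable {K S σ : Type*} [SetLike σ S] [CommRing S]

/-- `S⁺`: the non-zero homogeneous elements of a ring `S` with homogeneous components `𝒮 w`. -/
@[ext] structure Homog (𝒮 : K → σ) where
  val : S
  ne_zero : val ≠ 0
  isHomogeneous : SetLike.IsHomogeneousElem 𝒮 val

/-- A graded ring is `K`-simple if it is non-zero and all its non-zero homogeneous elements are
invertible. -/
class KSimple (𝒮 : K → σ) : Prop where
  nontrivial : Nontrivial S
  isUnit : ∀ x : S, x ≠ 0 → SetLike.IsHomogeneousElem 𝒮 x → IsUnit x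

/-- `ν : S⁺ → ℤ` is a discrete `K`-valuation on the `K`-simple ring `S`. -/
structure IsDiscreteKValuation (𝒮 : K → σ) (ν : Homog 𝒮 → ℤ) : Prop where
  map_mul : ∀ a b c : Homog 𝒮, c.val = a.val * b.val → ν c = ν a + ν b
  surjective : Function.Surjective ν
  min_le_add : ∀ (w : K) (a b c : Homog 𝒮), a.val ∈ 𝒮 w → b.val ∈ 𝒮 w → c.val = a.val + b.val →
    min (ν a) (ν b) ≤ ν c

/-- The discrete `K`-valuation ring of `ν`: the subring of `S` generated by the elements of `S⁺`
with non-negative value. -/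
def kValuationRing (𝒮 : K → σ) (ν : Homog 𝒮 → ℤ) : Subring S :=
  Subring.closure {x | ∃ a : Homog 𝒮, a.val = x ∧ 0 ≤ ν a}

end Graded

section Algebra

variable {K S σ : Type*} [AddCommGroup K] [DecidableEq K] [CommRing S] [SetLike σ S]
  [AddSubgroupClass σ S] (𝒮 : K → σ) [GradedRing 𝒮]
variable (R : Type*) [CommRing R] [Algebra R S]

/-- A set `V` of `K`-valuations on `S` defines `R` as a `K`-Krull ring in `S`. (As the finiteness
condition limits repetitions, families and sets of valuations are interchangeable.) -/
structure IsDefiningFamily (V : Set (Homog 𝒮 → ℤ)) : Prop where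
  isDiscreteKValuation : ∀ ν ∈ V, IsDiscreteKValuation 𝒮 ν
  range_eq : (algebraMap R S).range = ⨅ ν ∈ V, kValuationRing 𝒮 ν
  finite : ∀ a : Homog 𝒮, a.val ∈ (algebraMap R S).range → {ν ∈ V | ν a ≠ 0}.Finite

/-- (The image of) `R` is a graded subring of `S`. It then carries the grading with the components
`R ∩ 𝒮 w`; all notions for `R` below refer to this grading. -/
class IsGradedSubring : Prop where
  isHomogeneous : (1 : Submodule R S).IsHomogeneous 𝒮

variable {R}

/-- `K`-prime ideals: proper graded ideals that satisfy the condition of a prime ideal on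
homogeneous elements. -/
structure IsKPrime (q : Ideal R) : Prop where
  isHomogeneous : (Submodule.map (Algebra.linearMap R S) q).IsHomogeneous 𝒮
  ne_top : q ≠ ⊤
  mem_or_mem : ∀ a b : R, SetLike.IsHomogeneousElem 𝒮 (algebraMap R S a) →
    SetLike.IsHomogeneousElem 𝒮 (algebraMap R S b) → a * b ∈ q → a ∈ q ∨ b ∈ q

variable (R) in
/-- `K`-prime divisors: the minimal non-zero `K`-prime ideals. -/
structure KPrimeDivisor where
  ideal : Ideal R
  minimal : Minimal (fun q => IsKPrime 𝒮 q ∧ q ≠ ⊥) ideal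

variable (R) in
/-- The multiplicative monoid `R⁺` of homogeneous elements of `R` that are non-zero in the
`K`-simple ring `S`. -/
def homogSubmonoid [KSimple 𝒮] : Submonoid R where
  carrier := {r | algebraMap R S r ≠ 0 ∧ SetLike.IsHomogeneousElem 𝒮 (algebraMap R S r)}
  one_mem' := by
    have : Nontrivial S := KSimple.nontrivial (𝒮 := 𝒮)
    exact ⟨by simp, by rw [map_one]; exact SetLike.isHomogeneousElem_one 𝒮⟩
  mul_mem' := by
    rintro a b ⟨ha, ha'⟩ ⟨hb, hb'⟩
    refine ⟨fun h => hb ((KSimple.isUnit (𝒮 := 𝒮) _ ha ha').mul_right_eq_zero.1 (by rwa [← map_mul])),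
      by rw [map_mul]; exact ha'.mul hb'⟩

/-- The graded localization `R_q` by the homogeneous elements of `R` outside the `K`-prime ideal
`q`, as a subring of the `K`-simple ring `S` that contains `R`: all `x = r / s`. -/
def locAt (q : Ideal R) (hq : IsKPrime 𝒮 q) : Subring S where
  carrier := {x | ∃ s r : R, SetLike.IsHomogeneousElem 𝒮 (algebraMap R S s) ∧ s ∉ q ∧
    algebraMap R S s * x = algebraMap R S r}
  mul_mem' := by
    rintro x y ⟨s, r, hs, hsq, h⟩ ⟨s', r', hs', hsq', h'⟩
    refine ⟨s * s', r * r', by rw [map_mul]; exact hs.mul hs',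
      fun h0 => (hq.mem_or_mem _ _ hs hs' h0).elim hsq hsq', ?_⟩
    rw [map_mul, map_mul, ← h, ← h']
    ring
  one_mem' := ⟨1, 1, by rw [map_one]; exact SetLike.isHomogeneousElem_one 𝒮,
    fun h => hq.ne_top ((Ideal.eq_top_iff_one q).2 h), by simp⟩
  add_mem' := by
    rintro x y ⟨s, r, hs, hsq, h⟩ ⟨s', r', hs', hsq', h'⟩
    refine ⟨s * s', s' * r + s * r', by rw [map_mul]; exact hs.mul hs',
      fun h0 => (hq.mem_or_mem _ _ hs hs' h0).elim hsq hsq', ?_⟩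
    rw [map_add, map_mul, map_mul, map_mul, ← h, ← h']
    ring
  zero_mem' := ⟨1, 0, by rw [map_one]; exact SetLike.isHomogeneousElem_one 𝒮,
    fun h => hq.ne_top ((Ideal.eq_top_iff_one q).2 h), by simp⟩
  neg_mem' := by
    rintro x ⟨s, r, hs, hsq, h⟩
    exact ⟨s, -r, hs, hsq, by rw [mul_neg, h, map_neg]⟩

open Classical in
/-- The valuation `ν_q` at a `K`-prime ideal `q`: the (unique) discrete `K`-valuation on `S` with
`K`-valuation ring `R_q`. It exists for the `K`-prime divisors of a `K`-Krull ring `R` with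
homogeneous fraction ring `S`, and is set to `0` where there is none. -/
def valuationAt (q : Ideal R) (hq : IsKPrime 𝒮 q) : Homog 𝒮 → ℤ :=
  if h : ∃ ν, IsDiscreteKValuation 𝒮 ν ∧ kValuationRing 𝒮 ν = locAt 𝒮 q hq then h.choose else 0

theorem decompose_mem_kValuationRing (ν : Homog 𝒮 → ℤ) (x : S) (hx : x ∈ kValuationRing 𝒮 ν)
    (i : K) : (DirectSum.decompose 𝒮 x i : S) ∈ kValuationRing 𝒮 ν := by
  unfold kValuationRing at hx ⊢
  rw [Subring.mem_closure_iff] at hx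
  induction hx using AddSubgroup.closure_induction with
  | mem y hy =>
    have hh : y ∈ SetLike.homogeneousSubmonoid 𝒮 := by
      refine (Submonoid.closure_le (S := SetLike.homogeneousSubmonoid 𝒮)).2 ?_ hy
      rintro _ ⟨a, rfl, -⟩
      exact a.isHomogeneous
    obtain ⟨j, hj⟩ := hh
    by_cases hij : j = i
    · subst hij
      rw [DirectSum.decompose_of_mem_same _ hj]
      exact Subring.mem_closure_iff.2 (AddSubgroup.subset_closure hy)
    · rw [DirectSum.decompose_of_mem_ne _ hj hij]
      exact Subring.zero_mem _
  | zero =>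
    rw [DirectSum.decompose_zero]
    exact Subring.zero_mem _
  | add y z _ _ hy hz =>
    rw [DirectSum.decompose_add]
    exact Subring.add_mem _ hy hz
  | neg y _ hy =>
    rw [DirectSum.decompose_neg]
    exact Subring.neg_mem _ hy

/-! ### `K`-divisors -/

/-- `K`-fractional ideals: non-zero graded `R`-submodules `M` of `S` with `[R : M] ≠ 0`.
(In Mathlib's notation `[M : N]` is `M / N`, and `R` is `1`.) -/
structure IsKFractional (M : Submodule R S) : Prop where
  isHomogeneous : M.IsHomogeneous 𝒮
  ne_bot : M ≠ ⊥
  div_ne_bot : 1 / M ≠ ⊥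

variable (R) in
/-- `Div^K(R)`: the `K`-fractional ideals `M` with `[R : [R : M]] = M`. Here `S` is the homogeneous
fraction ring of `R`. -/
@[ext] structure KDiv where
  carrier : Submodule R S
  isKFractional : IsKFractional 𝒮 carrier
  div_div : 1 / (1 / carrier) = carrier

theorem le_div_div (M : Submodule R S) : M ≤ 1 / (1 / M) := by
  rw [Submodule.le_div_iff_mul_le]
  exact Submodule.mul_one_div_le_one

theorem div_div_div (M : Submodule R S) : 1 / (1 / (1 / M)) = 1 / M := by
  refine le_antisymm ?_ (le_div_div _)
  rw [Submodule.le_div_iff]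
  intro x hx z hz
  exact Submodule.mem_div_iff_forall_mul_mem.1 hx z (le_div_div M hz)

theorem div_mul_eq (M N : Submodule R S) : 1 / (M * N) = (1 / M) / N := by
  refine le_antisymm ?_ ?_
  · rw [Submodule.le_div_iff]
    intro x hx n hn
    rw [Submodule.mem_div_iff_forall_mul_mem]
    intro m hm
    rw [mul_assoc, mul_comm n m]
    exact Submodule.mem_div_iff_forall_mul_mem.1 hx _ (Submodule.mul_mem_mul hm hn)
  · rw [Submodule.le_div_iff_mul_le, mul_comm M N, ← mul_assoc, ← Submodule.le_div_iff_mul_le]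
    rw [← Submodule.le_div_iff_mul_le]

theorem closure_mul (M N : Submodule R S) :
    1 / (1 / ((1 / (1 / M)) * N)) = 1 / (1 / (M * N)) := by
  rw [div_mul_eq, div_div_div, ← div_mul_eq]

theorem exists_homog {M : Submodule R S} (hM : M.IsHomogeneous 𝒮) (h : M ≠ ⊥) :
    ∃ x ∈ M, x ≠ 0 ∧ SetLike.IsHomogeneousElem 𝒮 x := by
  obtain ⟨x, hx, hx0⟩ := Submodule.exists_mem_ne_zero_of_ne_bot h
  by_contra! hc
  refine hx0 ?_
  classical
  rw [← DirectSum.sum_support_decompose 𝒮 x]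
  refine Finset.sum_eq_zero fun i _ => ?_
  by_contra hi
  exact hc _ (hM i hx) hi ⟨i, SetLike.coe_mem _⟩

theorem isHomogeneous_of_forall {M : Submodule R S}
    (h : ∀ x ∈ M, ∀ i, (DirectSum.decompose 𝒮 x i : S) ∈ M) : M.IsHomogeneous 𝒮 :=
  fun i _ hx => h _ hx i

/-- Quotients of graded submodules are graded. -/
theorem isHomogeneous_div {M N : Submodule R S} (hM : M.IsHomogeneous 𝒮)
    (hN : N.IsHomogeneous 𝒮) : (M / N).IsHomogeneous 𝒮 := by
  refine isHomogeneous_of_forall 𝒮 fun x hx i => ?_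
  rw [Submodule.mem_div_iff_forall_mul_mem] at hx ⊢
  intro y hy
  classical
  rw [← DirectSum.sum_support_decompose 𝒮 y, Finset.mul_sum]
  refine Submodule.sum_mem _ fun j _ => ?_
  have h := hM (i + j) (hx _ (hN j hy))
  rwa [DirectSum.coe_decompose_mul_add_of_right_mem 𝒮 (SetLike.coe_mem _)] at h

variable {𝒮} in
/-- `[R : [R : M N]]` is a `K`-divisor if `M` and `N` are `K`-fractional ideals. -/
theorem IsKFractional.mul [KSimple 𝒮] [IsGradedSubring 𝒮 R] {M N : Submodule R S}
    (hM : IsKFractional 𝒮 M) (hN : IsKFractional 𝒮 N) :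
    IsKFractional 𝒮 (1 / (1 / (M * N))) := by
  have h1 : (1 : Submodule R S).IsHomogeneous 𝒮 := IsGradedSubring.isHomogeneous
  have key : ∀ {M N : Submodule R S}, M.IsHomogeneous 𝒮 → M ≠ ⊥ → N ≠ ⊥ →
      ∃ m ∈ M, ∃ n ∈ N, m * n ≠ 0 := by
    intro M N hM hM0 hN0
    obtain ⟨m, hm, hm0, hmh⟩ := exists_homog 𝒮 hM hM0
    obtain ⟨n, hn, hn0⟩ := Submodule.exists_mem_ne_zero_of_ne_bot hN0
    exact ⟨m, hm, n, hn, fun h => hn0 ((KSimple.isUnit _ hm0 hmh).mul_right_eq_zero.1 h)⟩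
  refine ⟨?_, ?_, ?_⟩
  · rw [div_mul_eq]
    exact isHomogeneous_div 𝒮 h1
      (isHomogeneous_div 𝒮 (isHomogeneous_div 𝒮 h1 hM.isHomogeneous) hN.isHomogeneous)
  · obtain ⟨m, hm, n, hn, h⟩ := key hM.isHomogeneous hM.ne_bot hN.ne_bot
    exact (Submodule.ne_bot_iff _).2 ⟨_, le_div_div _ (Submodule.mul_mem_mul hm hn), h⟩
  · rw [div_div_div]
    obtain ⟨m, hm, n, hn, h⟩ := key (isHomogeneous_div 𝒮 h1 hM.isHomogeneous)
      hM.div_ne_bot hN.div_ne_bot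
    refine (Submodule.ne_bot_iff _).2 ⟨m * n, ?_, h⟩
    rw [div_mul_eq, Submodule.mem_div_iff_forall_mul_mem]
    intro y hy
    rw [Submodule.mem_div_iff_forall_mul_mem]
    intro x hx
    have e : m * n * y * x = (m * x) * (n * y) := by ring
    rw [e]
    have := Submodule.mul_mem_mul (Submodule.mem_div_iff_forall_mul_mem.1 hm x hx)
      (Submodule.mem_div_iff_forall_mul_mem.1 hn y hy)
    rwa [one_mul] at this


theorem one_div_one : (1 : Submodule R S) / 1 = 1 := le_antisymm
  (fun x hx => by
    simpa using Submodule.mem_div_iff_forall_mul_mem.1 hx 1 (Submodule.one_le.1 le_rfl))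
  (Submodule.le_div_iff_mul_le.2 (by rw [one_mul]))

theorem isKFractional_one [KSimple 𝒮] [IsGradedSubring 𝒮 R] :
    IsKFractional 𝒮 (1 : Submodule R S) := by
  have : Nontrivial S := KSimple.nontrivial (𝒮 := 𝒮)
  have h0 : (1 : Submodule R S) ≠ ⊥ :=
    (Submodule.ne_bot_iff _).2 ⟨1, (Submodule.one_le.1 le_rfl), one_ne_zero⟩
  exact ⟨IsGradedSubring.isHomogeneous, h0, by rwa [one_div_one]⟩

variable [KSimple 𝒮] [IsGradedSubring 𝒮 R]

/-- The neutral element of `Div^K(R)` is `R`. -/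
instance : Zero (KDiv 𝒮 R) where
  zero := ⟨1, isKFractional_one 𝒮, by rw [one_div_one, one_div_one]⟩

/-- Addition of `K`-divisors is `a + b = [R : [R : a b]]`. -/
instance : Add (KDiv 𝒮 R) where
  add a b := ⟨1 / (1 / (a.carrier * b.carrier)), a.isKFractional.mul b.isKFractional,
    div_div_div _⟩

/-- `-a = [R : a]`, which is the inverse of `a` whenever `a` has one. -/
instance : Neg (KDiv 𝒮 R) where
  neg a := ⟨1 / a.carrier, ⟨isHomogeneous_div 𝒮 IsGradedSubring.isHomogeneous
    a.isKFractional.isHomogeneous, a.isKFractional.div_ne_bot,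
    by rw [a.div_div]; exact a.isKFractional.ne_bot⟩, div_div_div _⟩

variable {𝒮} in
theorem KDiv.carrier_zero : (0 : KDiv 𝒮 R).carrier = 1 := rfl

variable {𝒮} in
theorem KDiv.carrier_add (a b : KDiv 𝒮 R) :
    (a + b).carrier = 1 / (1 / (a.carrier * b.carrier)) := rfl

instance : AddCommMonoid (KDiv 𝒮 R) where
  add_assoc a b c := by
    ext1
    simp only [KDiv.carrier_add]
    rw [closure_mul, mul_comm a.carrier (1 / _), closure_mul, mul_assoc, mul_comm a.carrier,
      mul_assoc]
  zero_add a := by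
    ext1
    rw [KDiv.carrier_add, KDiv.carrier_zero, one_mul, a.div_div]
  add_zero a := by
    ext1
    rw [KDiv.carrier_add, KDiv.carrier_zero, mul_one, a.div_div]
  add_comm a b := by
    ext1
    rw [KDiv.carrier_add, KDiv.carrier_add, mul_comm]
  nsmul := nsmulRec

/-- The multiples `n • a` for integers `n`, with `(-n) • a = -(n • a)` for `n > 0`. -/
instance : SubNegMonoid (KDiv 𝒮 R) :=
  { (inferInstance : AddMonoid (KDiv 𝒮 R)), (inferInstance : Neg (KDiv 𝒮 R)) with
    zsmul := zsmulRec }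

/-- `a ≤ b` if and only if `a ⊇ b`. -/
instance : PartialOrder (KDiv 𝒮 R) where
  le a b := b.carrier ≤ a.carrier
  le_refl a := le_refl a.carrier
  le_trans a b c hab hbc := le_trans (α := Submodule R S) hbc hab
  le_antisymm a b hab hba := KDiv.ext (le_antisymm hba hab)

theorem mem_span_singleton_iff (u : Sˣ) (x : S) :
    x ∈ Submodule.span R {(u : S)} ↔ x * (↑u⁻¹ : S) ∈ (1 : Submodule R S) := by
  rw [Submodule.mem_span_singleton, Submodule.mem_one]
  refine exists_congr fun r => ?_
  rw [Algebra.smul_def, Units.eq_mul_inv_iff_mul_eq]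

theorem one_div_span_singleton (u : Sˣ) :
    1 / Submodule.span R {(u : S)} = Submodule.span R {(↑u⁻¹ : S)} := by
  ext x
  rw [mem_span_singleton_iff, inv_inv, Submodule.mem_div_iff_forall_mul_mem]
  refine ⟨fun h => h _ (Submodule.mem_span_singleton_self _), fun h y hy => ?_⟩
  obtain ⟨r, rfl⟩ := Submodule.mem_span_singleton.1 hy
  rw [mul_smul_comm]
  exact Submodule.smul_mem _ _ h

variable (R) in
/-- The `K`-principal divisor `div^K(f) = R f` of `f ∈ S⁺`. -/
def principalDiv (f : Homog 𝒮) : KDiv 𝒮 R where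
  carrier := Submodule.span R {f.val}
  isKFractional := by
    have : Nontrivial S := KSimple.nontrivial (𝒮 := 𝒮)
    obtain ⟨u, hu⟩ := KSimple.isUnit (𝒮 := 𝒮) f.val f.ne_zero f.isHomogeneous
    refine ⟨isHomogeneous_of_forall 𝒮 fun x hx i => ?_, ?_, ?_⟩
    · obtain ⟨w, hw⟩ := f.isHomogeneous
      obtain ⟨r, rfl⟩ := Submodule.mem_span_singleton.1 hx
      have h1 : (1 : Submodule R S).IsHomogeneous 𝒮 := IsGradedSubring.isHomogeneous
      obtain ⟨r', hr'⟩ := Submodule.mem_one.1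
        (h1 (i - w) (Submodule.mem_one.2 ⟨r, rfl⟩ : algebraMap R S r ∈ (1 : Submodule R S)))
      have h2 := DirectSum.coe_decompose_mul_add_of_right_mem 𝒮 (i := i - w)
        (a := algebraMap R S r) hw
      rw [sub_add_cancel] at h2
      rw [Algebra.smul_def, h2, ← hr', ← Algebra.smul_def]
      exact Submodule.smul_mem _ _ (Submodule.mem_span_singleton_self _)
    · exact (Submodule.ne_bot_iff _).2 ⟨_, Submodule.mem_span_singleton_self _, f.ne_zero⟩
    · rw [← hu, one_div_span_singleton]
      exact (Submodule.ne_bot_iff _).2 ⟨_, Submodule.mem_span_singleton_self _, u⁻¹.ne_zero⟩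
  div_div := by
    obtain ⟨u, hu⟩ := KSimple.isUnit (𝒮 := 𝒮) f.val f.ne_zero f.isHomogeneous
    rw [← hu, one_div_span_singleton, one_div_span_singleton, inv_inv]

/-- The congruence relation on a commutative monoid generated by `p ~ 0` for `p ∈ P`. -/
def quotientCon {M : Type*} [AddCommMonoid M] (P : Set M) : AddCon M :=
  addConGen fun x y => x ∈ P ∧ y = 0

variable (R) in
/-- The `K`-class semigroup `Cl^K(R)`: the cokernel of `div^K : S⁺ → Div^K(R)`. -/
abbrev KCl : Type _ := (quotientCon (Set.range (principalDiv 𝒮 R))).Quotient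

/-- The class of a `K`-divisor in `Cl^K(R)`. -/
def KCl.mk (D : KDiv 𝒮 R) : KCl 𝒮 R := (D : (quotientCon (Set.range (principalDiv 𝒮 R))).Quotient)

variable {𝒮} in
/-- The value `ν(D) = max {-ν(f) | f ∈ [R : D] ∩ S⁺}` of a `K`-divisor `D`. -/
def KDiv.value (ν : Homog 𝒮 → ℤ) (D : KDiv 𝒮 R) : ℤ :=
  sSup {n | ∃ f : Homog 𝒮, f.val ∈ 1 / D.carrier ∧ n = -ν f}

end Algebra

/-! ### Krull rings: the case `K = 0` -/

section Krull

/-- The grading of a ring `F` by the trivial group. -/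
def trivialGrading (F : Type*) [CommRing F] : Unit → AddSubgroup F := fun _ => ⊤

instance (F : Type*) [CommRing F] : GradedRing (trivialGrading F) where
  one_mem := AddSubgroup.mem_top _
  mul_mem _ _ _ _ _ _ := AddSubgroup.mem_top _
  decompose' x := DirectSum.of (fun i => trivialGrading F i) () ⟨x, AddSubgroup.mem_top _⟩
  left_inv x := by
    rw [DirectSum.coeAddMonoidHom_of]
  right_inv x := by
    induction x using DirectSum.induction_on with
    | zero => exact map_zero (DirectSum.of (fun i => trivialGrading F i) ())
    | of i x => simp
    | add x y hx hy =>
      rw [map_add]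
      conv_rhs => rw [← hx, ← hy, ← map_add]
      rfl

instance (F : Type*) [Field F] : KSimple (trivialGrading F) where
  nontrivial := inferInstance
  isUnit _ h _ := h.isUnit

variable (A F : Type*) [CommRing A] [Field F] [Algebra A F]

theorem isHomogeneous_trivialGrading {A F : Type*} [CommRing A] [Field F] [Algebra A F]
    (M : Submodule A F) : M.IsHomogeneous (trivialGrading F) := by
  intro i x hx
  have : (DirectSum.decompose (trivialGrading F) x i : F) = x :=
    DirectSum.decompose_of_mem_same _ (AddSubgroup.mem_top x)
  rwa [this]

instance : IsGradedSubring (trivialGrading F) A := ⟨isHomogeneous_trivialGrading _⟩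

/-- `A` with field of fractions `F` is a Krull ring: an intersection of discrete valuation rings of
`F` such that each non-zero element of `A` has non-zero value for only finitely many of them. -/
def IsKrullRing : Prop := ∃ V, IsDefiningFamily (trivialGrading F) A V

/-- Prime divisors of `A`: the minimal non-zero prime ideals. -/
structure PrimeDivisor where
  ideal : Ideal A
  minimal : Minimal (fun p => p.IsPrime ∧ p ≠ ⊥) ideal

/-- `Div(A)`: the divisorial fractional ideals of `A`. -/
abbrev Div : Type _ := KDiv (trivialGrading F) A

/-- `Cl(A)`: divisors modulo principal divisors. -/
abbrev Cl : Type _ := KCl (trivialGrading F) A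

variable {A}

theorem isKPrime_of_isPrime {p : Ideal A} (hp : p.IsPrime) : IsKPrime (trivialGrading F) p :=
  ⟨isHomogeneous_trivialGrading _, hp.ne_top, fun _ _ _ _ h => hp.mem_or_mem h⟩

/-- The localization `A_p` as a subring of the field of fractions `F`. -/
def primeLoc (p : PrimeDivisor A) : Subring F :=
  locAt (trivialGrading F) p.ideal (isKPrime_of_isPrime F p.minimal.prop.1)

/-- The essential valuation `ν_p` of `A`: the discrete valuation of `F` with valuation ring
`A_p`. -/
def essVal (p : PrimeDivisor A) : Homog (trivialGrading F) → ℤ :=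
  valuationAt (trivialGrading F) p.ideal (isKPrime_of_isPrime F p.minimal.prop.1)

end Krull

/-! ### The divisorial ring of a homomorphism `φ : K → Div(A)` -/

section Divisorial

open AddMonoidAlgebra

theorem eq_single_of_mem_grade {F K : Type*} [Field F] {x : AddMonoidAlgebra F K} {w : K} (h : x ∈ grade F w) :
    x = single w (x.coeff w) := by
  obtain ⟨a, rfl⟩ := (mem_grade_iff' F w x).1 h
  simp

variable {A F K : Type*} [CommRing A] [Field F] [Algebra A F] [AddCommGroup K] [DecidableEq K]

instance : KSimple (grade F : K → Submodule F (AddMonoidAlgebra F K)) where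
  nontrivial := inferInstance
  isUnit := by
    rintro x hx ⟨w, hw⟩
    rw [eq_single_of_mem_grade hw] at hx ⊢
    have ha : x.coeff w ≠ 0 := fun h => hx (by rw [h, single_zero])
    refine IsUnit.of_mul_eq_one (single (-w) (x.coeff w)⁻¹) ?_
    rw [single_mul_single, add_neg_cancel, mul_inv_cancel₀ ha, one_def]

variable (F K) in
/-- The natural `K`-grading of the group algebra `F[K]`, with components `F χ^w`. -/
abbrev gr : K → Submodule F (AddMonoidAlgebra F K) := grade F

variable (φ : K →+ Div A F)

/-- `μ_p(a χ^w) = ν_p(a) + ν_p(φ(w))` for `a χ^w ∈ F[K]⁺`. -/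
def mu (p : PrimeDivisor A) (x : Homog (gr F K)) : ℤ :=
  let w : K := x.isHomogeneous.choose
  essVal F p ⟨x.val.coeff w,
    fun h => x.ne_zero (by rw [eq_single_of_mem_grade x.isHomogeneous.choose_spec, h, single_zero]),
    ⟨(), AddSubgroup.mem_top _⟩⟩ + (φ w).value (essVal F p)

theorem mu_eq (p : PrimeDivisor A)
    (x : Homog (gr F K))
    (a : Homog (trivialGrading F)) (w : K) (h : x.val = single w a.val) :
    mu φ p x = essVal F p a + (φ w).value (essVal F p) := by
  have hw : x.isHomogeneous.choose = w := by
    have h1 := eq_single_of_mem_grade x.isHomogeneous.choose_spec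
    by_contra hne
    have h2 := congrArg (fun y => y.coeff w) (h.symm.trans h1)
    simp [hne, a.ne_zero] at h2
  unfold mu
  simp only
  congr 2
  · apply Homog.ext
    change x.val.coeff x.isHomogeneous.choose = a.val
    rw [hw, h]
    simp
  · rw [hw]

/-- The divisorial ring `R = ⋂_p F[K]_{μ_p}`. -/
def divRing : Subring (AddMonoidAlgebra F K) :=
  ⨅ p : PrimeDivisor A, kValuationRing (gr F K) (mu φ p)

/-- `R` is a graded subring of `F[K]`. -/
instance : IsGradedSubring (gr F K) (divRing φ) where
  isHomogeneous := by
    refine isHomogeneous_of_forall _ fun x hx i => ?_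
    obtain ⟨y, rfl⟩ := Submodule.mem_one.1 hx
    refine Submodule.mem_one.2 ⟨⟨_, Subring.mem_iInf.2 fun p => ?_⟩, rfl⟩
    exact decompose_mem_kValuationRing _ _ _ (Subring.mem_iInf.1 y.2 p) i

/-- `Div^K(R)`, formed in `F[K]`. -/
abbrev DivR : Type _ := KDiv (gr F K) (divRing φ)

/-- The `K`-prime divisors of `R`. -/
abbrev PrimeDivR : Type _ := KPrimeDivisor (gr F K) (divRing φ)

/-- The localization `R_q` at a `K`-prime divisor, as a subring of `F[K]`. -/
abbrev locR (q : PrimeDivR φ) : Subring (AddMonoidAlgebra F K) :=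
  locAt (gr F K) q.ideal q.minimal.prop.1

/-- The quotient `Cl(A) / im(φ̄)`, where `φ̄ : K → Cl(A)` is induced by `φ`. -/
abbrev ClModImage : Type _ :=
  (quotientCon (Set.range fun w : K => KCl.mk (trivialGrading F) (φ w))).Quotient

end Divisorial

end KKrull

end

set_option linter.unusedSectionVars false

noncomputable section

namespace KKrull

/-! ### Discrete `K`-valuations on `K`-simple rings. -/

section Valuations

variable {K S σ : Type*} [AddCommGroup K] [DecidableEq K] [CommRing S] [SetLike σ S]
  [AddSubgroupClass σ S] {𝒮 : K → σ} [GradedRing 𝒮] [KSimple 𝒮]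

theorem Homog.isUnit (a : Homog 𝒮) : IsUnit a.val :=
  KSimple.isUnit (𝒮 := 𝒮) _ a.ne_zero a.isHomogeneous

/-- Comparing degree-zero parts of `x * y = 1` shows that the component of `y` in degree `-w` is
already inverse to `x`; inverses are unique. -/
theorem isHomogeneousElem_of_mul_eq_one {x y : S} (hx : SetLike.IsHomogeneousElem 𝒮 x)
    (h : x * y = 1) : SetLike.IsHomogeneousElem 𝒮 y := by
  obtain ⟨w, hw⟩ := hx
  refine ⟨-w, ?_⟩
  have h1 := DirectSum.coe_decompose_mul_add_of_left_mem 𝒮 (j := -w) (b := y) hw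
  rw [add_neg_cancel, h, DirectSum.decompose_of_mem_same 𝒮 (SetLike.one_mem_graded 𝒮)] at h1
  have h2 : y = (DirectSum.decompose 𝒮 y (-w) : S) := by
    calc y = y * (x * (DirectSum.decompose 𝒮 y (-w) : S)) := by rw [← h1, mul_one]
      _ = x * y * (DirectSum.decompose 𝒮 y (-w) : S) := by ring
      _ = _ := by rw [h, one_mul]
  rw [h2]
  exact SetLike.coe_mem _

/-- In a `K`-simple ring, the non-zero homogeneous elements form an abelian group. -/
instance : CommGroup (Homog 𝒮) where
  mul a b := ⟨a.val * b.val,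
    fun h => b.ne_zero (a.isUnit.mul_right_eq_zero.1 h), a.isHomogeneous.mul b.isHomogeneous⟩
  one := ⟨1, by
    have : Nontrivial S := KSimple.nontrivial (𝒮 := 𝒮)
    exact one_ne_zero, SetLike.isHomogeneousElem_one 𝒮⟩
  inv a := ⟨↑a.isUnit.unit⁻¹, by
    have : Nontrivial S := KSimple.nontrivial (𝒮 := 𝒮)
    exact Units.ne_zero _, isHomogeneousElem_of_mul_eq_one a.isHomogeneous (by simp)⟩
  mul_assoc a b c := Homog.ext (mul_assoc _ _ _)
  one_mul a := Homog.ext (one_mul _)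
  mul_one a := Homog.ext (mul_one _)
  mul_comm a b := Homog.ext (mul_comm _ _)
  inv_mul_cancel a := Homog.ext (by
    change ↑a.isUnit.unit⁻¹ * a.val = 1
    simp)

instance : Neg (Homog 𝒮) where
  neg a := ⟨-a.val, neg_ne_zero.2 a.ne_zero, by
    obtain ⟨w, hw⟩ := a.isHomogeneous
    exact ⟨w, neg_mem hw⟩⟩

@[simp] theorem Homog.val_mul (a b : Homog 𝒮) : (a * b).val = a.val * b.val := rfl

@[simp] theorem Homog.val_one : (1 : Homog 𝒮).val = 1 := rfl

@[simp] theorem Homog.val_neg (a : Homog 𝒮) : (-a).val = -a.val := rfl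

theorem Homog.val_inv_mul (a : Homog 𝒮) : a⁻¹.val * a.val = 1 := by
  rw [← Homog.val_mul, inv_mul_cancel, Homog.val_one]

theorem Homog.val_mul_inv (a : Homog 𝒮) : a.val * a⁻¹.val = 1 := by
  rw [← Homog.val_mul, mul_inv_cancel, Homog.val_one]

/-- The homogeneous component of `x` in degree `w`, if it is non-zero. -/
@[simps val] def Homog.component (x : S) (w : K) (h : (DirectSum.decompose 𝒮 x w : S) ≠ 0) :
    Homog 𝒮 :=
  ⟨_, h, w, SetLike.coe_mem _⟩

namespace IsDiscreteKValuation

variable {ν : Homog 𝒮 → ℤ}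

theorem mul (hν : IsDiscreteKValuation 𝒮 ν) (a b : Homog 𝒮) : ν (a * b) = ν a + ν b :=
  hν.map_mul _ _ _ rfl

/-- A discrete `K`-valuation as a homomorphism of additive groups. -/
def toHom (hν : IsDiscreteKValuation 𝒮 ν) : Additive (Homog 𝒮) →+ ℤ :=
  AddMonoidHom.mk' (fun a => ν a.toMul) fun _ _ => hν.mul _ _

theorem one (hν : IsDiscreteKValuation 𝒮 ν) : ν 1 = 0 := hν.toHom.map_zero

theorem inv (hν : IsDiscreteKValuation 𝒮 ν) (a : Homog 𝒮) : ν a⁻¹ = -ν a :=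
  hν.toHom.map_neg (Additive.ofMul a)

theorem pow (hν : IsDiscreteKValuation 𝒮 ν) (a : Homog 𝒮) (n : ℕ) : ν (a ^ n) = n * ν a :=
  (hν.toHom.map_nsmul n (Additive.ofMul a)).trans (nsmul_eq_mul _ _)

theorem zpow (hν : IsDiscreteKValuation 𝒮 ν) (a : Homog 𝒮) (n : ℤ) : ν (a ^ n) = n * ν a :=
  (hν.toHom.map_zsmul n (Additive.ofMul a)).trans (smul_eq_mul _ _)

theorem prod (hν : IsDiscreteKValuation 𝒮 ν) {ι : Type*} (s : Finset ι) (f : ι → Homog 𝒮) :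
    ν (∏ i ∈ s, f i) = ∑ i ∈ s, ν (f i) :=
  map_sum hν.toHom (fun i => Additive.ofMul (f i)) s

theorem neg (hν : IsDiscreteKValuation 𝒮 ν) (a : Homog 𝒮) : ν (-a) = ν a := by
  have h1 : (-a) * (-a) = a * a := Homog.ext (by simp)
  have h2 := congrArg ν h1
  rw [hν.mul, hν.mul] at h2
  omega

end IsDiscreteKValuation

/-- The elements of `S` all of whose non-zero homogeneous components have value at least `n`. -/
def atLeastCarrier (ν : Homog 𝒮 → ℤ) (n : ℤ) : Set S :=
  {x | ∀ (w : K) (f : Homog 𝒮), f.val = DirectSum.decompose 𝒮 x w → n ≤ ν f}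

theorem Homog.mem_atLeastCarrier {ν : Homog 𝒮 → ℤ} {n : ℤ} {f : Homog 𝒮} :
    f.val ∈ atLeastCarrier ν n ↔ n ≤ ν f := by
  obtain ⟨w, hw⟩ := f.isHomogeneous
  refine ⟨fun h => h w f (DirectSum.decompose_of_mem_same _ hw).symm, fun h v g hg => ?_⟩
  by_cases hvw : w = v
  · subst hvw
    rw [DirectSum.decompose_of_mem_same _ hw] at hg
    rwa [Homog.ext hg]
  · rw [DirectSum.decompose_of_mem_ne _ hw hvw] at hg
    exact absurd hg g.ne_zero

theorem zero_mem_atLeastCarrier (ν : Homog 𝒮 → ℤ) (n : ℤ) : 0 ∈ atLeastCarrier ν n := by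
  intro w f hf
  simp only [DirectSum.decompose_zero, DirectSum.zero_apply, ZeroMemClass.coe_zero] at hf
  exact absurd hf f.ne_zero

theorem add_mem_atLeastCarrier {ν : Homog 𝒮 → ℤ} (hν : IsDiscreteKValuation 𝒮 ν) {n : ℤ} {x y : S}
    (hx : x ∈ atLeastCarrier ν n) (hy : y ∈ atLeastCarrier ν n) : x + y ∈ atLeastCarrier ν n := by
  intro w f hf
  rw [DirectSum.decompose_add, DirectSum.add_apply, AddMemClass.coe_add] at hf
  by_cases h1 : (DirectSum.decompose 𝒮 x w : S) = 0
  · rw [h1, zero_add] at hf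
    exact hy w f hf
  by_cases h2 : (DirectSum.decompose 𝒮 y w : S) = 0
  · rw [h2, add_zero] at hf
    exact hx w f hf
  exact (le_min (hx w (.component x w h1) rfl) (hy w (.component y w h2) rfl)).trans
    (hν.min_le_add w _ _ f (SetLike.coe_mem _) (SetLike.coe_mem _) hf)

/-- The elements of `S` all of whose non-zero homogeneous components have value at least `n`. -/
def atLeast {ν : Homog 𝒮 → ℤ} (hν : IsDiscreteKValuation 𝒮 ν) (n : ℤ) : AddSubgroup S where
  carrier := atLeastCarrier ν n
  zero_mem' := zero_mem_atLeastCarrier ν n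
  add_mem' := add_mem_atLeastCarrier hν
  neg_mem' := by
    intro x hx w f hf
    rw [← hν.neg]
    refine hx w _ ?_
    rw [Homog.val_neg, hf, DirectSum.decompose_neg]
    exact neg_neg _

section

variable {ν : Homog 𝒮 → ℤ} {hν : IsDiscreteKValuation 𝒮 ν} {n m : ℤ}

theorem Homog.mem_atLeast {f : Homog 𝒮} : f.val ∈ atLeast hν n ↔ n ≤ ν f :=
  Homog.mem_atLeastCarrier

theorem mem_atLeast_of_isHomogeneousElem {x : S} (hx : SetLike.IsHomogeneousElem 𝒮 x)
    (h : ∀ f : Homog 𝒮, f.val = x → n ≤ ν f) : x ∈ atLeast hν n := by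
  by_cases h0 : x = 0
  · rw [h0]
    exact zero_mem _
  · exact (Homog.mem_atLeast (f := ⟨x, h0, hx⟩)).2 (h _ rfl)

theorem decompose_mem_atLeast {x : S} (hx : x ∈ atLeast hν n) (w : K) :
    (DirectSum.decompose 𝒮 x w : S) ∈ atLeast hν n :=
  mem_atLeast_of_isHomogeneousElem ⟨w, SetLike.coe_mem _⟩ fun f hf => hx w f hf

theorem mul_mem_atLeast {x y : S} (hx : x ∈ atLeast hν n) (hy : y ∈ atLeast hν m) :
    x * y ∈ atLeast hν (n + m) := by
  classical
  rw [← DirectSum.sum_support_decompose 𝒮 x, ← DirectSum.sum_support_decompose 𝒮 y,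
    Finset.sum_mul_sum]
  refine sum_mem fun i hi => sum_mem fun j hj => ?_
  have h1 : (DirectSum.decompose 𝒮 x i : S) ≠ 0 := by simpa using hi
  have h2 : (DirectSum.decompose 𝒮 y j : S) ≠ 0 := by simpa using hj
  have h3 : (Homog.component x i h1 * Homog.component y j h2 : Homog 𝒮).val ∈ atLeast hν (n + m) := by
    rw [Homog.mem_atLeast, hν.mul]
    exact add_le_add (hx i _ rfl) (hy j _ rfl)
  exact h3

/-- The condition on components is closed under products and sums, so the generated subring is no
larger; conversely, an element is the sum of its components. -/
theorem mem_kValuationRing_iff {x : S} : x ∈ kValuationRing 𝒮 ν ↔ x ∈ atLeast hν 0 := by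
  constructor
  · intro hx
    unfold kValuationRing at hx
    induction hx using Subring.closure_induction with
    | mem y hy =>
      obtain ⟨a, rfl, ha⟩ := hy
      exact Homog.mem_atLeast.2 ha
    | zero => exact zero_mem _
    | one => exact (Homog.mem_atLeast (f := 1)).2 hν.one.ge
    | add _ _ _ _ h1 h2 => exact add_mem h1 h2
    | neg _ _ h => exact neg_mem h
    | mul _ _ _ _ h1 h2 => exact mul_mem_atLeast h1 h2
  · intro hx
    classical
    rw [← DirectSum.sum_support_decompose 𝒮 x]
    refine Subring.sum_mem _ fun i hi => Subring.subset_closure ?_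
    have h1 : (DirectSum.decompose 𝒮 x i : S) ≠ 0 := by simpa using hi
    exact ⟨.component x i h1, rfl, hx i _ rfl⟩

end

theorem Homog.mem_kValuationRing {ν : Homog 𝒮 → ℤ} (hν : IsDiscreteKValuation 𝒮 ν) {f : Homog 𝒮} :
    f.val ∈ kValuationRing 𝒮 ν ↔ 0 ≤ ν f :=
  (mem_kValuationRing_iff (hν := hν)).trans Homog.mem_atLeast

/-- A discrete `K`-valuation is determined by the elements of non-negative value. -/
theorem IsDiscreteKValuation.ext {ν ν' : Homog 𝒮 → ℤ} (hν : IsDiscreteKValuation 𝒮 ν)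
    (hν' : IsDiscreteKValuation 𝒮 ν') (h : ∀ f, 0 ≤ ν f → 0 ≤ ν' f) : ν = ν' := by
  obtain ⟨t, ht⟩ := hν.surjective 1
  have key : ∀ f, ν' f = ν f * ν' t := by
    intro f
    -- The element `f * t ^ (-ν f)` and its inverse both have `ν`-value zero, so `ν'` is
    -- non-negative on both and vanishes there.
    have h1 := h (f * t ^ (-ν f)) (by rw [hν.mul, hν.zpow, ht]; simp)
    have h2 := h (f * t ^ (-ν f))⁻¹ (by rw [hν.inv, hν.mul, hν.zpow, ht]; simp)
    rw [hν'.inv] at h2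
    have h3 : ν' (f * t ^ (-ν f)) = 0 := by omega
    rw [hν'.mul, hν'.zpow] at h3
    linarith
  have h1 : ν' t = 1 := by
    obtain ⟨s, hs⟩ := hν'.surjective 1
    rw [key] at hs
    have h0 : 0 ≤ ν' t := h t (by omega)
    exact Int.eq_one_of_mul_eq_one_left h0 hs
  funext f
  rw [key f, h1, mul_one]

theorem IsDiscreteKValuation.eq_of_kValuationRing_le {ν ν' : Homog 𝒮 → ℤ}
    (hν : IsDiscreteKValuation 𝒮 ν) (hν' : IsDiscreteKValuation 𝒮 ν')
    (h : kValuationRing 𝒮 ν ≤ kValuationRing 𝒮 ν') : ν = ν' :=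
  hν.ext hν' fun _ hf => (Homog.mem_kValuationRing hν').1 (h ((Homog.mem_kValuationRing hν).2 hf))

end Valuations

/-! ### Defining families, essential families and minimality. -/

section Families

variable {K S σ : Type*} [AddCommGroup K] [DecidableEq K] [CommRing S] [SetLike σ S]
  [AddSubgroupClass σ S] {𝒮 : K → σ} [GradedRing 𝒮] [KSimple 𝒮]
  {R : Type*} [CommRing R] [Algebra R S] {ι ι' : Type*}

variable (R) in
/-- `f` lies in the image of `R`. -/
def Homog.IsIntegral (f : Homog 𝒮) : Prop := f.val ∈ (algebraMap R S).range

theorem Homog.IsIntegral.mul {f g : Homog 𝒮} (hf : f.IsIntegral R) (hg : g.IsIntegral R) :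
    (f * g).IsIntegral R :=
  Subring.mul_mem _ hf hg

variable (R) in
/-- An indexed family of discrete `K`-valuations on the homogeneous fraction ring of `R` that
defines `R`, expressed in terms of homogeneous elements. -/
structure IsKrullFamily (ν : ι → Homog 𝒮 → ℤ) : Prop where
  disc : ∀ i, IsDiscreteKValuation 𝒮 (ν i)
  integral_iff : ∀ f : Homog 𝒮, f.IsIntegral R ↔ ∀ i, 0 ≤ ν i f
  finite : ∀ f : Homog 𝒮, f.IsIntegral R → {i | ν i f ≠ 0}.Finite
  exists_denom : ∀ f : Homog 𝒮, ∃ m : Homog 𝒮, m.IsIntegral R ∧ (m * f).IsIntegral R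

namespace IsKrullFamily

variable {ν : ι → Homog 𝒮 → ℤ}

theorem finite_ne_zero (h : IsKrullFamily R ν) (f : Homog 𝒮) : {i | ν i f ≠ 0}.Finite := by
  obtain ⟨m, hm, hmf⟩ := h.exists_denom f
  refine ((h.finite m hm).union (h.finite _ hmf)).subset fun i hi => ?_
  by_contra hc
  simp only [Set.mem_union, Set.mem_ofPred_eq, not_or, not_not] at hc hi
  rw [(h.disc i).mul] at hc
  omega

/-- By minimality, an integral multiplier that keeps `z` non-integral has value zero at every pole
of `z`. Applied to `m * z ^ k`, with `k` the last exponent before powers of `z` first destroy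
integrality, this determines `m` at all poles simultaneously. -/
theorem exists_eq_mul_of_minimal (h : IsKrullFamily R ν) {z : Homog 𝒮} (hz : ¬ z.IsIntegral R)
    (hmin : ∀ m : Homog 𝒮, m.IsIntegral R → ¬ (m * z).IsIntegral R →
      ∀ i, ν i z < 0 → ν i m = 0) {m : Homog 𝒮} (hm : m.IsIntegral R) :
    ∃ k : ℕ, ∀ i, ν i z < 0 → ν i m = k * (-ν i z) := by
  obtain ⟨i₀, hi₀⟩ : ∃ i, ν i z < 0 := by simpa [h.integral_iff] using hz
  classical
  have hex : ∃ k : ℕ, ¬ (m * z ^ (k + 1)).IsIntegral R := by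
    -- Each factor `z` lowers the value at the pole `i₀` by at least one, so `ν i₀ m + 1` factors
    -- make it negative.
    refine ⟨(ν i₀ m).toNat, fun hc => ?_⟩
    have h1 := (h.integral_iff _).1 hc i₀
    have h2 := (h.integral_iff _).1 hm i₀
    rw [(h.disc i₀).mul, (h.disc i₀).pow] at h1
    push_cast at h1
    rw [Int.toNat_of_nonneg h2] at h1
    nlinarith
  have hk : (m * z ^ Nat.find hex).IsIntegral R := by
    rcases hj : Nat.find hex with _ | j
    · simpa using hm
    · exact not_not.1 (Nat.find_min hex (hj ▸ Nat.lt_succ_self j))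
  refine ⟨Nat.find hex, fun i hi => ?_⟩
  have h1 := hmin _ hk (by simpa [pow_succ, mul_assoc] using Nat.find_spec hex) i hi
  rw [(h.disc i).mul, (h.disc i).pow] at h1
  linarith

theorem exists_minimal (h : IsKrullFamily R ν) {f : Homog 𝒮} (hf : ¬ f.IsIntegral R) :
    ∃ m : Homog 𝒮, m.IsIntegral R ∧ ¬ (m * f).IsIntegral R ∧
      ∀ m' : Homog 𝒮, m'.IsIntegral R → ¬ (m' * (m * f)).IsIntegral R →
        ∀ i, ν i (m * f) < 0 → ν i m' = 0 := by
  have hfin : {i | ν i f < 0}.Finite := (h.finite_ne_zero f).subset fun i hi => hi.ne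
  -- The total pole order of `m * f`: integral multipliers create no poles, so only the finitely
  -- many poles of `f` matter.
  let N : Homog 𝒮 → ℕ := fun m => ∑ i ∈ hfin.toFinset, (-ν i (m * f)).toNat
  obtain ⟨m, ⟨hm, hmf⟩, hmin⟩ := (measure N).wf.has_min
    {m | m.IsIntegral R ∧ ¬ (m * f).IsIntegral R}
    ⟨1, (h.integral_iff 1).2 fun i => (h.disc i).one.ge, by rwa [one_mul]⟩
  refine ⟨m, hm, hmf, fun m' hm' hmf' i hi => ?_⟩
  by_contra h0
  refine hmin (m' * m) ⟨hm'.mul hm, by rwa [mul_assoc]⟩ ?_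
  change N (m' * m) < N m
  have hnn : ∀ j, 0 ≤ ν j m' := (h.integral_iff _).1 hm'
  refine Finset.sum_lt_sum (fun j _ => ?_) ⟨i, ?_, ?_⟩
  · have := hnn j
    rw [mul_assoc, (h.disc j).mul m']
    omega
  · have := (h.integral_iff _).1 hm i
    rw [(h.disc i).mul] at hi
    simp only [Set.Finite.mem_toFinset, Set.mem_ofPred_eq]
    omega
  · have := hnn i
    rw [mul_assoc, (h.disc i).mul m']
    omega

/-- A fraction outside `R` has a multiple that fails to be integral at a single valuation. -/
theorem exists_separating (h : IsKrullFamily R ν) {f : Homog 𝒮} (hf : ¬ f.IsIntegral R) :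
    ∃ m : Homog 𝒮, m.IsIntegral R ∧ ∃ i, ν i (m * f) = -1 ∧
      ∀ j, ν j ≠ ν i → 0 ≤ ν j (m * f) := by
  obtain ⟨m, hm, hz, hmin⟩ := h.exists_minimal hf
  refine ⟨m, hm, ?_⟩
  generalize m * f = z at hz hmin
  obtain ⟨i, hi⟩ : ∃ i, ν i z < 0 := by simpa [h.integral_iff] using hz
  -- Writing `t` as a quotient of integral elements extends the proportionality to all of `S⁺`. The
  -- factor `k` is the same at all poles of `z`: this makes the poles simple and their valuations
  -- equal.
  have key : ∀ t : Homog 𝒮, ∃ k : ℤ, ∀ i, ν i z < 0 → ν i t = k * (-ν i z) := by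
    intro t
    obtain ⟨a, ha, hat⟩ := h.exists_denom t
    obtain ⟨k, hk⟩ := h.exists_eq_mul_of_minimal hz hmin ha
    obtain ⟨l, hl⟩ := h.exists_eq_mul_of_minimal hz hmin hat
    refine ⟨l - k, fun i hi => ?_⟩
    have h1 := hl i hi
    rw [(h.disc i).mul, hk i hi] at h1
    linarith
  have hone : ∀ j, ν j z < 0 → ν j z = -1 := by
    intro j hj
    obtain ⟨t, ht⟩ := (h.disc j).surjective 1
    obtain ⟨k, hk⟩ := key t
    have h1 := hk j hj
    rw [ht] at h1
    have := Int.eq_one_of_mul_eq_one_left (by omega) h1.symm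
    omega
  refine ⟨i, hone i hi, fun j hij => ?_⟩
  by_contra! hj
  refine hij (funext fun t => ?_)
  obtain ⟨k, hk⟩ := key t
  rw [hk i hi, hk j hj, hone i hi, hone j hj]

/-- An element with one simple pole allows the value there to be read off from integrality alone,
which does not depend on the defining family. -/
theorem integral_mul_pow_iff (h : IsKrullFamily R ν) {i : ι} {z : Homog 𝒮} (hi : ν i z = -1)
    (hz : ∀ j, ν j ≠ ν i → 0 ≤ ν j z) {m : Homog 𝒮} (hm : m.IsIntegral R) (k : ℕ) :
    (m * z ^ k).IsIntegral R ↔ k ≤ ν i m := by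
  rw [h.integral_iff] at hm ⊢
  constructor
  · intro h1
    have := h1 i
    rw [(h.disc i).mul, (h.disc i).pow, hi] at this
    omega
  · intro h1 j
    rw [(h.disc j).mul, (h.disc j).pow]
    by_cases hj : ν j = ν i
    · rw [hj, hi]
      omega
    · have := hz j hj
      have := hm j
      positivity

/-- A valuation that can be separated from the other valuations of a defining family belongs to
every defining family. -/
theorem exists_eq (h : IsKrullFamily R ν) {ν' : ι' → Homog 𝒮 → ℤ} (h' : IsKrullFamily R ν')
    {i : ι} {z : Homog 𝒮} (hi : ν i z = -1) (hz : ∀ j, ν j ≠ ν i → 0 ≤ ν j z) :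
    ∃ i', ν' i' = ν i := by
  obtain ⟨m, hm, i', hi', hz'⟩ := h'.exists_separating (f := z) fun hc => by
    have := (h.integral_iff _).1 hc i
    omega
  refine ⟨i', Eq.symm ((h.disc i).ext (h'.disc i') fun f hf => ?_)⟩
  have hnn : ∀ j, 0 ≤ ν j m := (h.integral_iff _).1 hm
  have hz1 : ∀ j, ν j ≠ ν i → 0 ≤ ν j (m * z) := fun j hj => by
    rw [(h.disc j).mul]
    exact add_nonneg (hnn j) (hz j hj)
  -- Since `m * z` has a pole at `i'`, it is not integral, so multiplication by `m` has not
  -- cancelled the only pole of `z` in the family `ν`.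
  have hi1 : ν i (m * z) = -1 := by
    have h1 : ¬ (m * z).IsIntegral R := fun hc => by
      have := (h'.integral_iff _).1 hc i'
      omega
    by_contra h2
    refine h1 ((h.integral_iff _).2 fun j => ?_)
    by_cases hj : ν j = ν i
    · have := hnn i
      rw [(h.disc i).mul] at h2
      rw [hj, (h.disc i).mul]
      omega
    · exact hz1 j hj
  -- With `k = ν' i' a`, the two integrality criteria give `k ≤ ν i a`, hence `k ≤ ν i (a * f)`,
  -- hence `k ≤ ν' i' (a * f)`.
  obtain ⟨a, ha, haf⟩ := h.exists_denom f
  obtain ⟨k, hk⟩ := Int.eq_ofNat_of_zero_le ((h'.integral_iff _).1 ha i')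
  have h1 := (h.integral_mul_pow_iff hi1 hz1 ha k).1
    ((h'.integral_mul_pow_iff hi' hz' ha k).2 hk.ge)
  have h2 := (h'.integral_mul_pow_iff hi' hz' haf k).1
    ((h.integral_mul_pow_iff hi1 hz1 haf k).2 (by rw [(h.disc i).mul]; omega))
  rw [(h'.disc i').mul] at h2
  omega

end IsKrullFamily

variable (R) in
/-- A defining family in which every valuation can be separated from the others. -/
structure IsEssentialFamily (ν : ι → Homog 𝒮 → ℤ) : Prop extends IsKrullFamily R ν where
  exists_sep : ∀ i, ∃ z : Homog 𝒮, ν i z = -1 ∧ ∀ j, j ≠ i → 0 ≤ ν j z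

theorem IsDefiningFamily.isKrullFamily {V : Set (Homog 𝒮 → ℤ)} (hV : IsDefiningFamily 𝒮 R V)
    (hR : ∀ f : Homog 𝒮, ∃ m : Homog 𝒮, m.IsIntegral R ∧ (m * f).IsIntegral R) :
    IsKrullFamily R (fun ν : V => ν.1) where
  disc i := hV.isDiscreteKValuation _ i.2
  integral_iff f := by
    rw [Homog.IsIntegral, hV.range_eq]
    simp only [Subring.mem_iInf, Subtype.forall]
    exact forall₂_congr fun ν hν => Homog.mem_kValuationRing (hV.isDiscreteKValuation ν hν)
  finite f hf := by
    refine Set.Finite.of_finite_image (f := Subtype.val) ((hV.finite f hf).subset ?_)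
      Subtype.val_injective.injOn
    rintro _ ⟨i, hi, rfl⟩
    exact ⟨i.2, hi⟩
  exists_denom := hR

/-- The separable members of a defining family form an essential family. -/
theorem IsKrullFamily.isEssentialFamily {ν : ι → Homog 𝒮 → ℤ} (h : IsKrullFamily R ν)
    (hinj : Function.Injective ν) :
    IsEssentialFamily R
      (fun i : {i // ∃ z : Homog 𝒮, ν i z = -1 ∧ ∀ j, j ≠ i → 0 ≤ ν j z} => ν i.1) where
  disc i := h.disc i
  integral_iff f := by
    refine ⟨fun hf i => (h.integral_iff f).1 hf i, fun hf => ?_⟩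
    by_contra hc
    -- A non-integral `f` would have a multiple with a pole at a separable index `i`, although `m`
    -- and `f` are both non-negative there.
    obtain ⟨m, hm, i, hi, hz⟩ := h.exists_separating hc
    have h1 := hf ⟨i, m * f, hi, fun j hj => hz j (hinj.ne hj)⟩
    have h2 := (h.integral_iff m).1 hm i
    rw [(h.disc i).mul] at hi
    simp only at h1
    omega
  finite f hf := (h.finite f hf).preimage Subtype.val_injective.injOn
  exists_denom := h.exists_denom
  exists_sep i := by
    obtain ⟨z, hz, hz'⟩ := i.2
    exact ⟨z, hz, fun j hj => hz' j fun hc => hj (Subtype.ext hc)⟩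

namespace IsEssentialFamily

variable {ν : ι → Homog 𝒮 → ℤ}

theorem injective (h : IsEssentialFamily R ν) : Function.Injective ν := by
  intro i j hij
  by_contra hne
  obtain ⟨z, hz, hz'⟩ := h.exists_sep i
  have := hz' j (Ne.symm hne)
  rw [← hij] at this
  omega

theorem isDefiningFamily [IsGradedSubring 𝒮 R] (h : IsEssentialFamily R ν) :
    IsDefiningFamily 𝒮 R (Set.range ν) where
  isDiscreteKValuation := by
    rintro _ ⟨i, rfl⟩
    exact h.disc i
  range_eq := by
    have h1 : (1 : Submodule R S).IsHomogeneous 𝒮 := IsGradedSubring.isHomogeneous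
    ext x
    simp only [Subring.mem_iInf, Set.forall_mem_range]
    constructor
    · intro hx i
      rw [mem_kValuationRing_iff (hν := h.disc i)]
      intro w f hf
      refine (h.integral_iff f).1 ?_ i
      rw [Homog.IsIntegral, hf]
      exact Submodule.mem_one.1 (h1 w (Submodule.mem_one.2 hx))
    · intro hx
      classical
      rw [← DirectSum.sum_support_decompose 𝒮 x]
      refine Subring.sum_mem _ fun w hw => ?_
      have h1 : (DirectSum.decompose 𝒮 x w : S) ≠ 0 := by simpa using hw
      refine (h.integral_iff (.component x w h1)).2 fun i => ?_
      exact (mem_kValuationRing_iff (hν := h.disc i)).1 (hx i) w _ rfl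
  finite f hf := by
    refine ((h.finite f hf).image ν).subset ?_
    rintro _ ⟨⟨i, rfl⟩, hi⟩
    exact ⟨i, hi, rfl⟩

/-- The valuations of an essential family form the smallest defining family. -/
theorem isLeast [IsGradedSubring 𝒮 R] (h : IsEssentialFamily R ν) :
    IsLeast {V | IsDefiningFamily 𝒮 R V} (Set.range ν) := by
  refine ⟨h.isDefiningFamily, ?_⟩
  rintro V hV _ ⟨i, rfl⟩
  obtain ⟨z, hz, hz'⟩ := h.exists_sep i
  obtain ⟨j, hj⟩ := h.exists_eq (IsDefiningFamily.isKrullFamily hV h.exists_denom) hz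
    fun j hj => hz' j fun hc => hj (by rw [hc])
  exact hj ▸ j.2

end IsEssentialFamily

end Families

/-! ### Approximation and the group of `K`-divisors. -/

section Divisors

variable {K S σ : Type*} [AddCommGroup K] [DecidableEq K] [CommRing S] [SetLike σ S]
  [AddSubgroupClass σ S] {𝒮 : K → σ} [GradedRing 𝒮] [KSimple 𝒮]
  {R : Type*} [CommRing R] [Algebra R S] {ι : Type*} {ν : ι → Homog 𝒮 → ℤ}

namespace IsEssentialFamily

theorem exists_eq_and_nonneg (h : IsEssentialFamily R ν) (i : ι) (k : ℤ) :
    ∃ f : Homog 𝒮, ν i f = k ∧ ∀ j, j ≠ i → 0 ≤ ν j f := by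
  obtain ⟨z, hz, hz'⟩ := h.exists_sep i
  obtain ⟨a, ha, haz⟩ := h.exists_denom z
  have hai : 1 ≤ ν i a := by
    have := (h.integral_iff _).1 haz i
    rw [(h.disc i).mul] at this
    omega
  have hle : k ≤ ν i (a ^ k.toNat) := by
    rw [(h.disc i).pow]
    have := Int.self_le_toNat k
    nlinarith
  -- The denominator `a` cancels the pole of `z`, so it has value at least `1` at `i`. A power of
  -- `a` overshoots `k`, and each factor `z` lowers the value at `i` by one.
  refine ⟨a ^ k.toNat * z ^ (ν i (a ^ k.toNat) - k).toNat, ?_, fun j hj => ?_⟩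
  · rw [(h.disc i).mul, (h.disc i).pow z, hz]
    omega
  · have := hz' j hj
    have := (h.integral_iff _).1 ha j
    rw [(h.disc j).mul, (h.disc j).pow, (h.disc j).pow]
    positivity

theorem exists_one_zero (h : IsEssentialFamily R ν) {i j : ι} (hij : i ≠ j) :
    ∃ f : Homog 𝒮, f.IsIntegral R ∧ 1 ≤ ν i f ∧ ν j f = 0 := by
  obtain ⟨y, hy, hy'⟩ := h.exists_eq_and_nonneg i 1
  obtain ⟨z, hz, hz'⟩ := h.exists_sep j
  have h1 := hy' j hij.symm
  have h2 := hz' i hij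
  -- Here `z` has its only pole at `j`, so the power of `z` brings the value at `j` down to zero and
  -- cannot lower the value at `i`.
  refine ⟨y * z ^ (ν j y).toNat, (h.integral_iff _).2 fun l => ?_, ?_, ?_⟩
  · rw [(h.disc l).mul, (h.disc l).pow]
    by_cases hl : l = j
    · subst hl
      rw [hz]
      omega
    · have := hz' l hl
      have : 0 ≤ ν l y := by
        by_cases hl' : l = i
        · subst hl'
          omega
        · exact hy' l hl'
      positivity
  · rw [(h.disc i).mul, (h.disc i).pow, hy]
    have : 0 ≤ ((ν j y).toNat : ℤ) * ν i z := by positivity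
    omega
  · rw [(h.disc j).mul, (h.disc j).pow, hz]
    omega

/-- Approximation: prescribe the value at one valuation and lower bounds at the others. -/
theorem exists_approx (h : IsEssentialFamily R ν) (n : ι →₀ ℤ) (i : ι) :
    ∃ f : Homog 𝒮, ν i f = n i ∧ ∀ j, n j ≤ ν j f := by
  classical
  have hex : ∀ j, ∃ f : Homog 𝒮, f.IsIntegral R ∧ ν i f = 0 ∧ (j ≠ i → 1 ≤ ν j f) := by
    intro j
    by_cases hj : j = i
    · exact ⟨1, (h.integral_iff _).2 fun l => (h.disc l).one.ge, (h.disc i).one,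
        fun hc => absurd hj hc⟩
    · obtain ⟨f, hf, h1, h2⟩ := h.exists_one_zero hj
      exact ⟨f, hf, h2, fun _ => h1⟩
  choose y hy hyi hyj using hex
  obtain ⟨f, hf, hf'⟩ := h.exists_eq_and_nonneg i (n i)
  have hnn : ∀ j l, 0 ≤ ν j (y l ^ (n l).toNat) := fun j l => by
    have := (h.integral_iff _).1 (hy l) j
    rw [(h.disc j).pow]
    positivity
  -- The factor `f` fixes the value at `i`; each `y l` raises the value at `l ≠ i` without changing
  -- the one at `i`.
  refine ⟨f * ∏ l ∈ n.support, y l ^ (n l).toNat, ?_, fun j => ?_⟩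
  · rw [(h.disc i).mul, (h.disc i).prod, hf, Finset.sum_eq_zero, add_zero]
    intro l _
    rw [(h.disc i).pow, hyi, mul_zero]
  · rw [(h.disc j).mul, (h.disc j).prod]
    have hsum : 0 ≤ ∑ l ∈ n.support, ν j (y l ^ (n l).toNat) :=
      Finset.sum_nonneg fun l _ => hnn j l
    by_cases hji : j = i
    · subst hji
      omega
    · have h1 := hf' j hji
      by_cases hj : j ∈ n.support
      · have h2 := Finset.single_le_sum (f := fun l => ν j (y l ^ (n l).toNat))
          (fun l _ => hnn j l) hj
        simp only [(h.disc j).pow (y j)] at h2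
        have h3 := hyj j hji
        have h4 := Int.self_le_toNat (n j)
        nlinarith
      · rw [Finsupp.notMem_support_iff] at hj
        omega

variable [IsGradedSubring 𝒮 R]

theorem algebraMap_mem_atLeast (h : IsEssentialFamily R ν) (i : ι) (r : R) :
    algebraMap R S r ∈ atLeast (h.disc i) 0 := by
  have h1 : algebraMap R S r ∈ (algebraMap R S).range := ⟨r, rfl⟩
  rw [h.isDefiningFamily.range_eq] at h1
  simp only [Subring.mem_iInf, Set.forall_mem_range] at h1
  exact mem_kValuationRing_iff.1 (h1 i)

/-- The divisorial submodule of all elements with values at least `n`. -/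
def divisorial (h : IsEssentialFamily R ν) (n : ι →₀ ℤ) : Submodule R S where
  carrier := {x | ∀ i, x ∈ atLeast (h.disc i) (n i)}
  zero_mem' _ := zero_mem _
  add_mem' hx hy i := add_mem (hx i) (hy i)
  smul_mem' r x hx i := by
    rw [Algebra.smul_def, ← zero_add (n i)]
    exact mul_mem_atLeast (h.algebraMap_mem_atLeast i r) (hx i)

theorem val_mem_divisorial (h : IsEssentialFamily R ν) {n : ι →₀ ℤ} {f : Homog 𝒮} :
    f.val ∈ h.divisorial n ↔ ∀ i, n i ≤ ν i f :=
  forall_congr' fun _ => Homog.mem_atLeast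

theorem divisorial_zero (h : IsEssentialFamily R ν) : h.divisorial 0 = 1 := by
  ext x
  rw [Submodule.mem_one]
  change _ ↔ x ∈ (algebraMap R S).range
  rw [h.isDefiningFamily.range_eq]
  simp only [Subring.mem_iInf, Set.forall_mem_range]
  exact forall_congr' fun i => mem_kValuationRing_iff.symm

theorem isHomogeneous_divisorial (h : IsEssentialFamily R ν) (n : ι →₀ ℤ) :
    (h.divisorial n).IsHomogeneous 𝒮 :=
  isHomogeneous_of_forall 𝒮 fun _ hx w i => decompose_mem_atLeast (hx i) w

/-- The bound at `i` need only be attained by some element of `N` depending on `i`: dividing by it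
gives the lower bound `-n i` on `1 / N`. Thus `N` can be a product or a span whose divisorial hull
is wanted. -/
theorem one_div_eq (h : IsEssentialFamily R ν) {N : Submodule R S} {n : ι →₀ ℤ}
    (hle : N ≤ h.divisorial n) (hex : ∀ i, ∃ f : Homog 𝒮, f.val ∈ N ∧ ν i f = n i) :
    1 / N = h.divisorial (-n) := by
  ext x
  rw [Submodule.mem_div_iff_forall_mul_mem, ← h.divisorial_zero]
  constructor
  · intro hx i
    obtain ⟨f, hf, hfi⟩ := hex i
    have h1 := mul_mem_atLeast (hx _ hf i)
      (Homog.mem_atLeast (hν := h.disc i) (f := f⁻¹) (n := -n i) |>.2 (by rw [(h.disc i).inv, hfi]))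
    rwa [mul_assoc, f.val_mul_inv, mul_one, Finsupp.zero_apply, zero_add] at h1
  · intro hx y hy i
    have h1 := mul_mem_atLeast (hx i) (hle hy i)
    rwa [Finsupp.neg_apply, neg_add_cancel] at h1

theorem one_div_divisorial (h : IsEssentialFamily R ν) (n : ι →₀ ℤ) :
    1 / h.divisorial n = h.divisorial (-n) :=
  h.one_div_eq le_rfl fun i => by
    obtain ⟨f, hf, hf'⟩ := h.exists_approx n i
    exact ⟨f, h.val_mem_divisorial.2 hf', hf⟩

theorem exists_mem_divisorial (h : IsEssentialFamily R ν) (n : ι →₀ ℤ) :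
    ∃ f : Homog 𝒮, ∀ i, n i ≤ ν i f := by
  by_cases hι : Nonempty ι
  · obtain ⟨f, -, hf⟩ := h.exists_approx n hι.some
    exact ⟨f, hf⟩
  · exact ⟨1, fun i => (hι ⟨i⟩).elim⟩

theorem divisorial_ne_bot (h : IsEssentialFamily R ν) (n : ι →₀ ℤ) : h.divisorial n ≠ ⊥ := by
  obtain ⟨f, hf⟩ := h.exists_mem_divisorial n
  exact (Submodule.ne_bot_iff _).2 ⟨f.val, h.val_mem_divisorial.2 hf, f.ne_zero⟩

theorem divisorial_le_iff (h : IsEssentialFamily R ν) {n m : ι →₀ ℤ} :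
    h.divisorial n ≤ h.divisorial m ↔ m ≤ n := by
  constructor
  · intro hle i
    obtain ⟨f, hf, hf'⟩ := h.exists_approx n i
    rw [← hf]
    exact h.val_mem_divisorial.1 (hle (h.val_mem_divisorial.2 hf')) i
  · intro hmn x hx i w f hf
    exact (hmn i).trans (hx i w f hf)

/-- The `K`-divisor of all elements with values at least `n`. -/
def ofFinsupp (h : IsEssentialFamily R ν) (n : ι →₀ ℤ) : KDiv 𝒮 R where
  carrier := h.divisorial n
  isKFractional := ⟨h.isHomogeneous_divisorial n, h.divisorial_ne_bot n, by
    rw [h.one_div_divisorial]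
    exact h.divisorial_ne_bot _⟩
  div_div := by rw [h.one_div_divisorial, h.one_div_divisorial, neg_neg]

theorem div_div_eq (h : IsEssentialFamily R ν) {N : Submodule R S} {n : ι →₀ ℤ}
    (hle : N ≤ h.divisorial n) (hex : ∀ i, ∃ f : Homog 𝒮, f.val ∈ N ∧ ν i f = n i) :
    1 / (1 / N) = h.divisorial n := by
  rw [h.one_div_eq hle hex, h.one_div_divisorial, neg_neg]

theorem ofFinsupp_surjective (h : IsEssentialFamily R ν) : Function.Surjective h.ofFinsupp := by
  intro D
  obtain ⟨x, hx, hx0, hxh⟩ := exists_homog 𝒮 D.isKFractional.isHomogeneous D.isKFractional.ne_bot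
  obtain ⟨y, hy, hy0, hyh⟩ := exists_homog 𝒮 (isHomogeneous_div 𝒮 IsGradedSubring.isHomogeneous
    D.isKFractional.isHomogeneous) D.isKFractional.div_ne_bot
  let d : Homog 𝒮 := ⟨x, hx0, hxh⟩
  let e : Homog 𝒮 := ⟨y, hy0, hyh⟩
  have hbd : ∀ i, ∀ f : Homog 𝒮, f.val ∈ D.carrier → -ν i e ≤ ν i f := by
    intro i f hf
    have h1 := Submodule.mem_div_iff_forall_mul_mem.1 hy _ hf
    have h2 := (h.integral_iff (e * f)).1 (Submodule.mem_one.1 h1) i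
    rw [(h.disc i).mul] at h2
    omega
  have hleast : ∀ i, ∃ v, IsLeast {k | ∃ f : Homog 𝒮, f.val ∈ D.carrier ∧ k = ν i f} v := by
    intro i
    obtain ⟨v, hv, hv'⟩ := Int.exists_least_of_bdd
      (P := fun k => ∃ f : Homog 𝒮, f.val ∈ D.carrier ∧ k = ν i f)
      ⟨-ν i e, by rintro _ ⟨f, hf, rfl⟩; exact hbd i f hf⟩ ⟨_, d, hx, rfl⟩
    exact ⟨v, hv, hv'⟩
  choose v hv using hleast
  -- The least value on `D` lies between `-ν i e` and `ν i d`, and so is zero wherever `d` and `e`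
  -- both have value zero.
  let n : ι →₀ ℤ := Finsupp.ofSupportFinite v (by
    refine ((h.finite_ne_zero d).union (h.finite_ne_zero e)).subset fun i hi => ?_
    by_contra hc
    simp only [Set.mem_union, Set.mem_ofPred_eq, not_or, not_not] at hc
    obtain ⟨f, hf, hfv⟩ := (hv i).1
    have h1 := hbd i f hf
    have h2 := (hv i).2 ⟨d, hx, rfl⟩
    exact hi (by omega))
  refine ⟨n, KDiv.ext ?_⟩
  rw [← D.div_div]
  refine (h.div_div_eq (n := n) (fun z hz i w f hf => (hv i).2 ⟨f, ?_, rfl⟩) fun i => ?_).symm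
  · rw [hf]
    exact D.isKFractional.isHomogeneous w hz
  · obtain ⟨f, hf, hfv⟩ := (hv i).1
    exact ⟨f, hf, hfv.symm⟩

theorem ofFinsupp_add (h : IsEssentialFamily R ν) (n m : ι →₀ ℤ) :
    h.ofFinsupp (n + m) = h.ofFinsupp n + h.ofFinsupp m := by
  refine KDiv.ext ?_
  rw [KDiv.carrier_add]
  refine (h.div_div_eq ?_ fun i => ?_).symm
  · rw [Submodule.mul_le]
    exact fun x hx y hy i => mul_mem_atLeast (hx i) (hy i)
  · obtain ⟨f, hf, hf'⟩ := h.exists_approx n i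
    obtain ⟨g, hg, hg'⟩ := h.exists_approx m i
    exact ⟨f * g, Submodule.mul_mem_mul (h.val_mem_divisorial.2 hf') (h.val_mem_divisorial.2 hg'),
      by rw [(h.disc i).mul, hf, hg, Finsupp.add_apply]⟩

theorem ofFinsupp_le_iff (h : IsEssentialFamily R ν) {n m : ι →₀ ℤ} :
    h.ofFinsupp n ≤ h.ofFinsupp m ↔ n ≤ m :=
  h.divisorial_le_iff

/-- `K`-divisors are finite formal sums of the members of an essential family. -/
def divEquiv (h : IsEssentialFamily R ν) : (ι →₀ ℤ) ≃+o KDiv 𝒮 R where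
  toEquiv := Equiv.ofBijective h.ofFinsupp
    ⟨fun _ _ e => le_antisymm (h.ofFinsupp_le_iff.1 e.le) (h.ofFinsupp_le_iff.1 e.ge),
      h.ofFinsupp_surjective⟩
  map_add' := h.ofFinsupp_add
  map_le_map_iff' := h.ofFinsupp_le_iff

theorem carrier_divEquiv (h : IsEssentialFamily R ν) (n : ι →₀ ℤ) :
    (h.divEquiv n).carrier = h.divisorial n := rfl

theorem value_divEquiv (h : IsEssentialFamily R ν) (n : ι →₀ ℤ) (i : ι) :
    (h.divEquiv n).value (ν i) = n i := by
  refine IsGreatest.csSup_eq ⟨?_, ?_⟩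
  · obtain ⟨f, hf, hf'⟩ := h.exists_approx (-n) i
    refine ⟨f, ?_, by rw [hf, Finsupp.neg_apply, neg_neg]⟩
    rw [h.carrier_divEquiv, h.one_div_divisorial]
    exact h.val_mem_divisorial.2 hf'
  · rintro _ ⟨f, hf, rfl⟩
    rw [h.carrier_divEquiv, h.one_div_divisorial] at hf
    have := h.val_mem_divisorial.1 hf i
    rw [Finsupp.neg_apply] at this
    omega

theorem value_eq (h : IsEssentialFamily R ν) (D : KDiv 𝒮 R) (i : ι) :
    D.value (ν i) = h.divEquiv.symm D i := by
  rw [← h.value_divEquiv, OrderAddMonoidIso.apply_symm_apply]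

theorem value_add (h : IsEssentialFamily R ν) (D D' : KDiv 𝒮 R) (i : ι) :
    (D + D').value (ν i) = D.value (ν i) + D'.value (ν i) := by
  rw [h.value_eq, h.value_eq, h.value_eq, map_add, Finsupp.add_apply]

theorem value_zero (h : IsEssentialFamily R ν) (i : ι) :
    (0 : KDiv 𝒮 R).value (ν i) = 0 := by
  have := h.value_add 0 0 i
  rw [add_zero] at this
  omega

theorem finite_value_ne_zero (h : IsEssentialFamily R ν) (D : KDiv 𝒮 R) :
    {i | D.value (ν i) ≠ 0}.Finite := by
  simp only [h.value_eq]
  exact (h.divEquiv.symm D).hasFiniteSupport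

theorem eq_of_value_eq (h : IsEssentialFamily R ν) {D D' : KDiv 𝒮 R}
    (hD : ∀ i, D.value (ν i) = D'.value (ν i)) : D = D' := by
  have h1 : h.divEquiv.symm D = h.divEquiv.symm D' := Finsupp.ext fun i => by
    rw [← h.value_eq, ← h.value_eq, hD]
  exact h.divEquiv.symm.injective h1

theorem eq_divEquiv_of_forall (h : IsEssentialFamily R ν) {D : KDiv 𝒮 R} {n : ι →₀ ℤ}
    (hle : D.carrier ≤ h.divisorial n) (hex : ∀ i, ∃ f : Homog 𝒮, f.val ∈ D.carrier ∧ ν i f = n i) :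
    D = h.divEquiv n :=
  KDiv.ext (by rw [← D.div_div, h.div_div_eq hle hex, h.carrier_divEquiv])

theorem value_principalDiv (h : IsEssentialFamily R ν) (f : Homog 𝒮) (i : ι) :
    (principalDiv 𝒮 R f).value (ν i) = ν i f := by
  let n : ι →₀ ℤ := Finsupp.ofSupportFinite (fun i => ν i f) (h.finite_ne_zero f)
  have h1 : principalDiv 𝒮 R f = h.divEquiv n := by
    refine h.eq_divEquiv_of_forall ?_ fun i => ⟨f, Submodule.mem_span_singleton_self _, rfl⟩
    refine (Submodule.span_singleton_le_iff_mem _ _).2 (h.val_mem_divisorial.2 fun i => le_rfl)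
  rw [h1, h.value_divEquiv]
  rfl

/-- Negative multiples in `KDiv` are defined through `[R : a]`, so additivity alone does not cover
them; `one_div_divisorial` identifies this operation with negation. -/
theorem divEquiv_zsmul (h : IsEssentialFamily R ν) (k : ℤ) (n : ι →₀ ℤ) :
    h.divEquiv (k • n) = k • h.divEquiv n := by
  have hnat : ∀ k : ℕ, h.divEquiv (k • n) = k • h.divEquiv n := fun k =>
    map_nsmul h.divEquiv.toAddEquiv k n
  obtain ⟨k, rfl | rfl⟩ := k.eq_nat_or_neg
  · rw [natCast_zsmul, hnat, natCast_zsmul]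
  · rcases k with _ | k
    · simp
    · have h1 : (-((k + 1 : ℕ) : ℤ)) • h.divEquiv n = -((k + 1 : ℕ) • h.divEquiv n) := rfl
      rw [h1, ← hnat, neg_smul, natCast_zsmul]
      refine KDiv.ext ?_
      exact (h.one_div_divisorial _).symm

/-- Every `K`-divisor is the sum of its values times the standard divisors. -/
theorem eq_finsum (h : IsEssentialFamily R ν) (D : KDiv 𝒮 R) :
    D = ∑ᶠ i, D.value (ν i) • h.divEquiv (Finsupp.single i 1) := by
  rw [finsum_eq_sum_of_support_subset (s := (h.divEquiv.symm D).support)]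
  · conv_lhs => rw [← h.divEquiv.apply_symm_apply D,
      ← Finsupp.sum_single (h.divEquiv.symm D), Finsupp.sum]
    rw [map_sum]
    refine Finset.sum_congr rfl fun i _ => ?_
    rw [h.value_eq, ← h.divEquiv_zsmul, Finsupp.smul_single_one]
  · intro i hi
    rw [Function.mem_support, h.value_eq] at hi
    rw [Finset.mem_coe, Finsupp.mem_support_iff]
    intro h0
    rw [h0] at hi
    exact hi (zero_zsmul _)

end IsEssentialFamily

end Divisors

/-! ### `K`-prime divisors as centers of essential valuations. -/

section Primes

variable {K S σ : Type*} [AddCommGroup K] [DecidableEq K] [CommRing S] [SetLike σ S]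
  [AddSubgroupClass σ S] {𝒮 : K → σ} [GradedRing 𝒮] [KSimple 𝒮]
  {R : Type*} [CommRing R] [Algebra R S] {ι : Type*} {ν : ι → Homog 𝒮 → ℤ}

/-- A graded ideal is contained in every ideal that contains its homogeneous elements. -/
theorem ideal_le_of_homogeneous (hinj : Function.Injective (algebraMap R S)) {q q' : Ideal R}
    (hq : (Submodule.map (Algebra.linearMap R S) q).IsHomogeneous 𝒮)
    (hle : ∀ (f : Homog 𝒮) (r : R), f.val = algebraMap R S r → r ∈ q → r ∈ q') : q ≤ q' := by
  intro r hr
  have h1 : algebraMap R S r ∈ Submodule.map (Algebra.linearMap R S) q' := by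
    classical
    rw [← DirectSum.sum_support_decompose 𝒮 (algebraMap R S r)]
    refine Submodule.sum_mem _ fun w hw => ?_
    have h2 : (DirectSum.decompose 𝒮 (algebraMap R S r) w : S) ≠ 0 := by simpa using hw
    obtain ⟨t, ht, ht'⟩ := hq w (Submodule.mem_map_of_mem (f := Algebra.linearMap R S) hr)
    exact ⟨t, hle (.component _ w h2) t ht'.symm ht, ht'⟩
  obtain ⟨t, ht, ht'⟩ := h1
  rwa [← hinj ht']

/-- The homogeneous elements outside a `K`-prime ideal. -/
def IsKPrime.complement {q : Ideal R} (hq : IsKPrime 𝒮 q) : Submonoid R where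
  carrier := {r | SetLike.IsHomogeneousElem 𝒮 (algebraMap R S r) ∧ r ∉ q}
  one_mem' := ⟨by rw [map_one]; exact SetLike.isHomogeneousElem_one 𝒮,
    fun h => hq.ne_top ((Ideal.eq_top_iff_one q).2 h)⟩
  mul_mem' := fun ha hb => ⟨by rw [map_mul]; exact ha.1.mul hb.1,
    fun h => (hq.mem_or_mem _ _ ha.1 hb.1 h).elim ha.2 hb.2⟩

namespace IsEssentialFamily

variable [IsGradedSubring 𝒮 R]

/-- The ideal of all elements of `R` of positive value at `i`. -/
def center (h : IsEssentialFamily R ν) (i : ι) : Ideal R :=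
  (h.divisorial (Finsupp.single i 1)).comap (Algebra.linearMap R S)

theorem mem_center (h : IsEssentialFamily R ν) {i : ι} {r : R} :
    r ∈ h.center i ↔ algebraMap R S r ∈ atLeastCarrier (ν i) 1 := by
  constructor
  · intro hr
    have := hr i
    rwa [Finsupp.single_eq_same] at this
  · intro hr j
    by_cases hj : j = i
    · subst hj
      rwa [Finsupp.single_eq_same]
    · rw [Finsupp.single_eq_of_ne hj]
      exact h.algebraMap_mem_atLeast j r

theorem homog_mem_center (h : IsEssentialFamily R ν) {i : ι} {r : R} {f : Homog 𝒮}
    (hf : f.val = algebraMap R S r) : r ∈ h.center i ↔ 0 < ν i f := by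
  rw [h.mem_center, ← hf, Homog.mem_atLeastCarrier]
  exact ⟨fun h => by omega, fun h => by omega⟩

theorem map_center (h : IsEssentialFamily R ν) (i : ι) :
    Submodule.map (Algebra.linearMap R S) (h.center i) = h.divisorial (Finsupp.single i 1) := by
  refine le_antisymm (Submodule.map_comap_le _ _) fun x hx => ?_
  have h1 : x ∈ (1 : Submodule R S) := by
    rw [← h.divisorial_zero]
    exact h.divisorial_le_iff.2 (Finsupp.single_nonneg.2 zero_le_one) hx
  obtain ⟨r, rfl⟩ := Submodule.mem_one.1 h1
  exact ⟨r, hx, rfl⟩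

theorem isKPrime_center (h : IsEssentialFamily R ν) (i : ι) : IsKPrime 𝒮 (h.center i) where
  isHomogeneous := by
    rw [h.map_center]
    exact h.isHomogeneous_divisorial _
  ne_top := by
    rw [Ne, Ideal.eq_top_iff_one, h.homog_mem_center (f := 1) (by simp), (h.disc i).one]
    exact lt_irrefl _
  mem_or_mem := by
    intro a b ha hb hab
    by_cases ha0 : algebraMap R S a = 0
    · left
      rw [h.mem_center, ha0]
      exact zero_mem_atLeastCarrier _ _
    by_cases hb0 : algebraMap R S b = 0
    · right
      rw [h.mem_center, hb0]
      exact zero_mem_atLeastCarrier _ _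
    let f : Homog 𝒮 := ⟨_, ha0, ha⟩
    let g : Homog 𝒮 := ⟨_, hb0, hb⟩
    rw [h.homog_mem_center (f := f * g) (map_mul _ _ _).symm, (h.disc i).mul] at hab
    rw [h.homog_mem_center (f := f) rfl, h.homog_mem_center (f := g) rfl]
    omega

theorem center_ne_bot (h : IsEssentialFamily R ν) (i : ι) : h.center i ≠ ⊥ := by
  intro hc
  refine h.divisorial_ne_bot (Finsupp.single i 1) ?_
  rw [← h.map_center, hc, Submodule.map_bot]

theorem center_le_iff (h : IsEssentialFamily R ν) {i j : ι} : h.center i ≤ h.center j ↔ i = j := by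
  refine ⟨fun hle => ?_, fun e => e ▸ le_rfl⟩
  by_contra hij
  obtain ⟨f, ⟨r, hr⟩, hi, hj⟩ := h.exists_one_zero hij
  have h1 := (h.homog_mem_center (f := f) hr.symm).1
    (hle ((h.homog_mem_center (f := f) hr.symm).2 (by omega)))
  omega

theorem center_eq_span (h : IsEssentialFamily R ν) (hinj : Function.Injective (algebraMap R S))
    (i : ι) :
    h.center i = Ideal.span {r | ∃ f : Homog 𝒮, f.val = algebraMap R S r ∧ 0 < ν i f} := by
  refine le_antisymm (ideal_le_of_homogeneous hinj (h.isKPrime_center i).isHomogeneous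
    fun f r hf hr => Ideal.subset_span ⟨f, hf, (h.homog_mem_center hf).1 hr⟩) (Ideal.span_le.2 ?_)
  rintro r ⟨f, hf, hpos⟩
  exact (h.homog_mem_center hf).2 hpos

/-- Otherwise each center has a homogeneous element `t i` outside `q`. For a non-zero homogeneous
`f` in `q`, the product of the `t i` with exponents `ν i f` is divisible by `f` in `R`, so lies in
`q`, against primality. -/
theorem exists_center_le (h : IsEssentialFamily R ν) (hinj : Function.Injective (algebraMap R S))
    {q : Ideal R} (hq : IsKPrime 𝒮 q) (hq0 : q ≠ ⊥) : ∃ i, h.center i ≤ q := by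
  obtain ⟨x, ⟨a, ha, rfl⟩, hx0, hxh⟩ := exists_homog 𝒮 hq.isHomogeneous (by
    intro hm
    refine hq0 ((Submodule.eq_bot_iff _).2 fun r hr => hinj ?_)
    have h1 := Submodule.mem_map_of_mem (f := Algebra.linearMap R S) hr
    rw [hm] at h1
    simpa using h1)
  let f : Homog 𝒮 := ⟨_, hx0, hxh⟩
  by_contra! hc
  have hex : ∀ i, ∃ (t : Homog 𝒮) (r : R), t.val = algebraMap R S r ∧ r ∈ h.center i ∧ r ∉ q := by
    intro i
    by_contra! hc'
    exact hc i (ideal_le_of_homogeneous hinj (h.isKPrime_center i).isHomogeneous hc')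
  choose t r htr hri hrq using hex
  let s := (h.finite_ne_zero f).toFinset
  let T : Homog 𝒮 := ∏ i ∈ s, t i ^ (ν i f).toNat
  let ρ : R := ∏ i ∈ s, r i ^ (ν i f).toNat
  have hTρ : T.val = algebraMap R S ρ := by
    let valHom : Homog 𝒮 →* S := ⟨⟨Homog.val, rfl⟩, fun _ _ => rfl⟩
    change valHom (∏ i ∈ s, t i ^ (ν i f).toNat) = algebraMap R S (∏ i ∈ s, r i ^ (ν i f).toNat)
    rw [map_prod, map_prod]
    refine Finset.prod_congr rfl fun i _ => ?_
    rw [map_pow, map_pow, ← htr]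
    rfl
  have hr : ∀ i, r i ∈ hq.complement := fun i => ⟨htr i ▸ (t i).isHomogeneous, hrq i⟩
  have hρ : ρ ∈ hq.complement := prod_mem fun i _ => pow_mem (hr i) _
  have ht1 : ∀ i, 1 ≤ ν i (t i) := fun i => (h.homog_mem_center (htr i)).1 (hri i)
  have ht0 : ∀ i j, 0 ≤ ν j (t i) := fun i j =>
    (h.integral_iff _).1 ⟨r i, (htr i).symm⟩ j
  have hquot : (f⁻¹ * T).IsIntegral R := by
    refine (h.integral_iff _).2 fun j => ?_
    rw [(h.disc j).mul, (h.disc j).inv, (h.disc j).prod]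
    have hnn : ∀ i ∈ s, 0 ≤ ν j (t i ^ (ν i f).toNat) := fun i _ => by
      have := ht0 i j
      rw [(h.disc j).pow]
      positivity
    by_cases hj : j ∈ s
    · have h2 := Finset.single_le_sum hnn hj
      simp only [(h.disc j).pow (t j)] at h2
      have := ht1 j
      have := Int.self_le_toNat (ν j f)
      nlinarith
    · have hj0 : ν j f = 0 := by simpa [s] using hj
      have := Finset.sum_nonneg hnn
      omega
  obtain ⟨b, hb⟩ := hquot
  refine hρ.2 ?_
  have h3 : ρ = b * a := by
    refine hinj ?_
    rw [← hTρ, map_mul, hb]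
    change _ = (f⁻¹ * T).val * f.val
    rw [Homog.val_mul, mul_right_comm, f.val_inv_mul, one_mul]
  rw [h3]
  exact q.mul_mem_left b ha

theorem minimal_center (h : IsEssentialFamily R ν) (hinj : Function.Injective (algebraMap R S))
    (i : ι) : Minimal (fun q => IsKPrime 𝒮 q ∧ q ≠ ⊥) (h.center i) := by
  refine ⟨⟨h.isKPrime_center i, h.center_ne_bot i⟩, fun q hq hle => ?_⟩
  obtain ⟨j, hj⟩ := h.exists_center_le hinj hq.1 hq.2
  rwa [h.center_le_iff.1 (hj.trans hle)] at hj

theorem exists_center_eq (h : IsEssentialFamily R ν) (hinj : Function.Injective (algebraMap R S))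
    {q : Ideal R} (hq : Minimal (fun q => IsKPrime 𝒮 q ∧ q ≠ ⊥) q) : ∃ i, h.center i = q := by
  obtain ⟨i, hi⟩ := h.exists_center_le hinj hq.prop.1 hq.prop.2
  exact ⟨i, le_antisymm hi (hq.le_of_le ⟨h.isKPrime_center i, h.center_ne_bot i⟩ hi)⟩

/-- The members of an essential family correspond to the `K`-prime divisors. -/
def centerEquiv (h : IsEssentialFamily R ν) (hinj : Function.Injective (algebraMap R S)) :
    ι ≃ KPrimeDivisor 𝒮 R :=
  Equiv.ofBijective (fun i => ⟨h.center i, h.minimal_center hinj i⟩)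
    ⟨fun i j hij => h.center_le_iff.1 (congrArg KPrimeDivisor.ideal hij).le, fun q => by
      obtain ⟨i, hi⟩ := h.exists_center_eq hinj q.minimal
      refine ⟨i, ?_⟩
      cases q
      simp only at hi
      subst hi
      rfl⟩

theorem ideal_centerEquiv (h : IsEssentialFamily R ν) (hinj : Function.Injective (algebraMap R S))
    (i : ι) : (h.centerEquiv hinj i).ideal = h.center i := rfl

/-- The valuation ring of a member of an essential family is the localization at its center. -/
theorem kValuationRing_eq (h : IsEssentialFamily R ν) (i : ι) {q : Ideal R} (hq : IsKPrime 𝒮 q)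
    (hqi : q = h.center i) : kValuationRing 𝒮 (ν i) = locAt 𝒮 q hq := by
  subst hqi
  ext x
  constructor
  · intro hx
    rw [mem_kValuationRing_iff (hν := h.disc i)] at hx
    classical
    rw [← DirectSum.sum_support_decompose 𝒮 x]
    refine Subring.sum_mem _ fun w hw => ?_
    have h0 : (DirectSum.decompose 𝒮 x w : S) ≠ 0 := by simpa using hw
    let f : Homog 𝒮 := .component x w h0
    have hf : 0 ≤ ν i f := hx w f rfl
    -- Approximating the pole orders of `f` gives a denominator `s`. As `f` has no pole at `i`, `s`
    -- has value exactly zero there and lies outside the center.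
    let n : ι →₀ ℤ := Finsupp.ofSupportFinite (fun j => max 0 (-ν j f))
      ((h.finite_ne_zero f).subset fun j hj hj0 => hj (by simp only; rw [hj0]; rfl))
    obtain ⟨s, hs, hs'⟩ := h.exists_approx n i
    change ν i s = max 0 (-ν i f) at hs
    change ∀ j, max 0 (-ν j f) ≤ ν j s at hs'
    obtain ⟨a, ha⟩ := (h.integral_iff s).2 fun j => (le_max_left _ _).trans (hs' j)
    obtain ⟨b, hb⟩ := (h.integral_iff (s * f)).2 fun j => by
      have := hs' j
      rw [(h.disc j).mul]
      omega
    refine ⟨a, b, by rw [ha]; exact s.isHomogeneous, ?_, by rw [ha, hb]; rfl⟩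
    rw [h.homog_mem_center ha.symm]
    omega
  · rintro ⟨s, r, hs, hsq, hx⟩
    have hs0 : algebraMap R S s ≠ 0 := fun h0 => hsq (by
      rw [h.mem_center, h0]
      exact zero_mem_atLeastCarrier _ _)
    let f : Homog 𝒮 := ⟨_, hs0, hs⟩
    rw [h.homog_mem_center (f := f) rfl] at hsq
    have hf : (0 : ℤ) ≤ ν i f⁻¹ := by
      rw [(h.disc i).inv]
      omega
    have hxe : x = f⁻¹.val * algebraMap R S r := by
      rw [← hx, ← mul_assoc, f.val_inv_mul, one_mul]
    rw [mem_kValuationRing_iff (hν := h.disc i), hxe, ← zero_add (0 : ℤ)]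
    exact mul_mem_atLeast (Homog.mem_atLeast.2 hf) (h.algebraMap_mem_atLeast i r)

theorem valuationAt_eq (h : IsEssentialFamily R ν) (i : ι) {q : Ideal R} (hq : IsKPrime 𝒮 q)
    (hqi : q = h.center i) : valuationAt 𝒮 q hq = ν i := by
  have hex : ∃ ν, IsDiscreteKValuation 𝒮 ν ∧ kValuationRing 𝒮 ν = locAt 𝒮 q hq :=
    ⟨ν i, h.disc i, h.kValuationRing_eq i hq hqi⟩
  rw [valuationAt, dif_pos hex]
  refine hex.choose_spec.1.eq_of_kValuationRing_le (h.disc i) ?_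
  rw [hex.choose_spec.2, h.kValuationRing_eq i hq hqi]

theorem reindex {ι' : Type*} (h : IsEssentialFamily R ν) (e : ι' ≃ ι) :
    IsEssentialFamily R (fun i => ν (e i)) where
  disc i := h.disc _
  integral_iff f := (h.integral_iff f).trans e.forall_congr_right.symm
  finite f hf := (h.finite f hf).preimage e.injective.injOn
  exists_denom := h.exists_denom
  exists_sep i := by
    obtain ⟨z, hz, hz'⟩ := h.exists_sep (e i)
    exact ⟨z, hz, fun j hj => hz' _ (e.injective.ne hj)⟩

end IsEssentialFamily

end Primes

/-! ### Cokernels of divisor monoids. -/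

section Quotients

variable {M N : Type*} [AddCommMonoid M] [AddCommMonoid N]

theorem quotientCon_le_ker {P : Set M} {f : M →+ N} (hf : ∀ x ∈ P, f x = 0) :
    quotientCon P ≤ AddCon.ker f := by
  refine AddCon.addConGen_le.2 ?_
  rintro x y ⟨hx, rfl⟩
  rw [AddCon.ker_rel, hf x hx, map_zero]

theorem mk_quotientCon_eq_zero {P : Set M} {x : M} (hx : x ∈ P) :
    (x : (quotientCon P).Quotient) = 0 :=
  (AddCon.eq _).2 (AddConGen.Rel.of _ _ ⟨hx, rfl⟩)

/-- An isomorphism descends to quotients, the second of which is taken in two steps. -/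
theorem exists_quotient_equiv (e : M ≃+ N) {P : Set M} {Q : Set N}
    {Q' : Set (quotientCon Q).Quotient}
    (hP : ∀ x ∈ P, (((e x : N) : (quotientCon Q).Quotient) : (quotientCon Q').Quotient) = 0)
    (hQ : ∀ y ∈ Q, ((e.symm y : M) : (quotientCon P).Quotient) = 0)
    (hQ' : ∀ c ∈ Q', ∃ y : N, (y : (quotientCon Q).Quotient) = c ∧
      ((e.symm y : M) : (quotientCon P).Quotient) = 0) :
    ∃ γ : (quotientCon P).Quotient ≃+ (quotientCon Q').Quotient, ∀ x : M,
      γ (x : (quotientCon P).Quotient) =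
        (((e x : N) : (quotientCon Q).Quotient) : (quotientCon Q').Quotient) := by
  let f : (quotientCon P).Quotient →+ (quotientCon Q').Quotient :=
    AddCon.lift _ ((AddCon.mk' _).comp ((AddCon.mk' (quotientCon Q)).comp e.toAddMonoidHom))
      (quotientCon_le_ker hP)
  let g' : (quotientCon Q).Quotient →+ (quotientCon P).Quotient :=
    AddCon.lift _ ((AddCon.mk' _).comp e.symm.toAddMonoidHom) (quotientCon_le_ker hQ)
  let g : (quotientCon Q').Quotient →+ (quotientCon P).Quotient :=
    AddCon.lift _ g' (quotientCon_le_ker fun c hc => by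
      obtain ⟨y, rfl, hy⟩ := hQ' c hc
      exact hy)
  refine ⟨AddMonoidHom.toAddEquiv f g ?_ ?_, fun x => rfl⟩
  · refine AddCon.hom_ext (AddMonoidHom.ext fun x => ?_)
    change ((e.symm (e x) : M) : (quotientCon P).Quotient) = x
    rw [e.symm_apply_apply]
  · refine AddCon.hom_ext (AddCon.hom_ext (AddMonoidHom.ext fun y => ?_))
    change (((e (e.symm y) : N) : (quotientCon Q).Quotient) : (quotientCon Q').Quotient) =
      ((y : (quotientCon Q).Quotient) : (quotientCon Q').Quotient)
    rw [e.apply_symm_apply]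

end Quotients

/-! ### The homogeneous fraction ring. -/

section Localization

variable {K S σ : Type*} [AddCommGroup K] [DecidableEq K] [CommRing S] [SetLike σ S]
  [AddSubgroupClass σ S] {𝒮 : K → σ} [GradedRing 𝒮] [KSimple 𝒮]
  {R : Type*} [CommRing R] [Algebra R S] {ι : Type*} {ν : ι → Homog 𝒮 → ℤ}

theorem IsKrullFamily.exists_common_denom (h : IsKrullFamily R ν) (x : S) :
    ∃ m : Homog 𝒮, m.IsIntegral R ∧ m.val * x ∈ (algebraMap R S).range := by
  classical
  rw [← DirectSum.sum_support_decompose 𝒮 x]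
  induction (DirectSum.decompose 𝒮 x).support using Finset.induction_on with
  | empty =>
    refine ⟨1, (h.integral_iff _).2 fun i => (h.disc i).one.ge, ?_⟩
    rw [Finset.sum_empty, mul_zero]
    exact zero_mem _
  | insert w s hw ih =>
    obtain ⟨m, hm, hms⟩ := ih
    rw [Finset.sum_insert hw]
    by_cases h0 : (DirectSum.decompose 𝒮 x w : S) = 0
    · exact ⟨m, hm, by rwa [h0, zero_add]⟩
    · obtain ⟨n, hn, hns⟩ := h.exists_denom (.component x w h0)
      refine ⟨m * n, hm.mul hn, ?_⟩
      rw [mul_add]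
      refine add_mem ?_ ?_
      · rw [Homog.val_mul, mul_assoc]
        exact Subring.mul_mem _ hm hns
      · rw [Homog.val_mul, mul_right_comm]
        exact Subring.mul_mem _ hms hn

theorem IsKrullFamily.isLocalization (h : IsKrullFamily R ν)
    (hinj : Function.Injective (algebraMap R S)) :
    IsLocalization (homogSubmonoid 𝒮 R) S where
  map_units m := KSimple.isUnit (𝒮 := 𝒮) _ m.2.1 m.2.2
  surj x := by
    obtain ⟨m, ⟨a, ha⟩, b, hb⟩ := h.exists_common_denom x
    refine ⟨(b, ⟨a, ?_, ?_⟩), ?_⟩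
    · rw [ha]
      exact m.ne_zero
    · rw [ha]
      exact m.isHomogeneous
    · rw [mul_comm, hb]
      simp only [ha]
  exists_of_eq hxy := ⟨1, by rw [hinj hxy]⟩

end Localization

/-! ### The essential family of a Krull ring. -/

section Krull

variable {A F : Type*} [CommRing A] [Field F] [Algebra A F]

theorem isHomogeneousElem_trivialGrading (x : F) :
    SetLike.IsHomogeneousElem (trivialGrading F) x := ⟨(), AddSubgroup.mem_top _⟩

variable (F) in
theorem isKPrime_iff_isPrime {p : Ideal A} :
    IsKPrime (trivialGrading F) p ↔ p.IsPrime :=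
  ⟨fun h => ⟨h.ne_top, fun hab => h.mem_or_mem _ _ (isHomogeneousElem_trivialGrading _)
    (isHomogeneousElem_trivialGrading _) hab⟩, isKPrime_of_isPrime F⟩

variable (A F) in
/-- The prime divisors of `A` are its `K`-prime divisors for `K = 0`. -/
@[simps] def primeDivisorEquiv : PrimeDivisor A ≃ KPrimeDivisor (trivialGrading F) A where
  toFun p := ⟨p.ideal, by simpa only [isKPrime_iff_isPrime] using p.minimal⟩
  invFun p := ⟨p.ideal, by simpa only [isKPrime_iff_isPrime] using p.minimal⟩
  left_inv _ := rfl
  right_inv _ := rfl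

variable [IsDomain A] [IsFractionRing A F]

theorem exists_denom_trivialGrading (f : Homog (trivialGrading F)) :
    ∃ m : Homog (trivialGrading F), m.IsIntegral A ∧ (m * f).IsIntegral A := by
  obtain ⟨a, b, hb, hab⟩ := IsFractionRing.div_surjective A f.val
  have hb0 : algebraMap A F b ≠ 0 := IsFractionRing.to_map_ne_zero_of_mem_nonZeroDivisors hb
  refine ⟨⟨_, hb0, isHomogeneousElem_trivialGrading _⟩, ⟨b, rfl⟩, a, ?_⟩
  rw [Homog.val_mul, ← hab]
  exact (mul_div_cancel₀ _ hb0).symm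

/-- The essential valuations of a Krull ring, and their centers. -/
theorem IsKrullRing.exists_essentialFamily (hA : IsKrullRing A F) :
    ∃ h : IsEssentialFamily A (essVal F : PrimeDivisor A → Homog (trivialGrading F) → ℤ),
      ∀ p, h.center p = p.ideal := by
  obtain ⟨V, hV⟩ := hA
  have h := (IsDefiningFamily.isKrullFamily hV exists_denom_trivialGrading).isEssentialFamily
    Subtype.val_injective
  have hinj := IsFractionRing.injective A F
  -- Separable members of `V` correspond to prime divisors through their centers; reindexing along
  -- this makes them the valuations `essVal F p`.
  let e := (primeDivisorEquiv A F).trans (h.centerEquiv hinj).symm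
  have he : ∀ p, p.ideal = h.center (e p) := fun p => by
    rw [← h.ideal_centerEquiv hinj]
    simp [e]
  have h' := h.reindex e
  have hess : (fun p : PrimeDivisor A => essVal F p) = fun p => (e p).1.1 :=
    funext fun p => h.valuationAt_eq (e p) _ (he p)
  have h'' : IsEssentialFamily A (fun p : PrimeDivisor A => essVal F p) := hess ▸ h'
  refine ⟨h'', fun p => ?_⟩
  ext a
  rw [he p, h''.mem_center, h.mem_center, ← congrFun hess p]

end Krull

/-! ### The divisorial ring `R` and the comparison with `A`. -/

section Divisorial

open AddMonoidAlgebra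

variable {A F K : Type*} [CommRing A] [Field F] [Algebra A F] [AddCommGroup K] [DecidableEq K]

/-- The non-zero homogeneous element `a χ^w` of `F[K]`. -/
@[simps val] def monomial (a : Homog (trivialGrading F)) (w : K) : Homog (gr F K) where
  val := single w a.val
  ne_zero := by
    rw [Ne, single_eq_zero]
    exact a.ne_zero
  isHomogeneous := ⟨w, single_mem_grade w a.val⟩

theorem exists_eq_monomial_of_mem {f : Homog (gr F K)} {w : K} (hf : f.val ∈ gr F K w) :
    ∃ a, f = monomial a w := by
  have h1 := eq_single_of_mem_grade hf
  exact ⟨⟨f.val.coeff w, fun h => f.ne_zero (by rw [h1, h, single_zero]),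
    isHomogeneousElem_trivialGrading _⟩, Homog.ext h1⟩

theorem exists_eq_monomial (f : Homog (gr F K)) : ∃ a w, f = monomial a w := by
  obtain ⟨w, hw⟩ := f.isHomogeneous
  obtain ⟨a, ha⟩ := exists_eq_monomial_of_mem hw
  exact ⟨a, w, ha⟩

theorem monomial_mul (a b : Homog (trivialGrading F)) (v w : K) :
    monomial a v * monomial b w = monomial (a * b) (v + w) :=
  Homog.ext (single_mul_single _ _ _ _)

variable (A F) in
/-- The essential valuations `ν_p` form an essential family for `A`. -/
abbrev HasEssentialFamily : Prop :=
  IsEssentialFamily A (essVal F : PrimeDivisor A → Homog (trivialGrading F) → ℤ)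

variable (φ : K →+ Div A F)

theorem mu_monomial (p : PrimeDivisor A) (a : Homog (trivialGrading F)) (w : K) :
    mu φ p (monomial a w) = essVal F p a + (φ w).value (essVal F p) :=
  mu_eq φ p _ a w rfl

theorem divRing_injective :
    Function.Injective (algebraMap (divRing φ) (AddMonoidAlgebra F K)) :=
  Subtype.val_injective

theorem isIntegral_divRing_iff {f : Homog (gr F K)} :
    f.IsIntegral (divRing φ) ↔ f.val ∈ divRing φ :=
  ⟨fun ⟨r, hr⟩ => hr ▸ r.2, fun h => ⟨⟨_, h⟩, rfl⟩⟩

variable {φ}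
theorem mu_monomial_zero (h : HasEssentialFamily A F)
    (p : PrimeDivisor A) (a : Homog (trivialGrading F)) :
    mu φ p (monomial a 0) = essVal F p a := by
  rw [mu_monomial, map_zero, h.value_zero, add_zero]

theorem isDiscreteKValuation_mu (h : HasEssentialFamily A F)
    (p : PrimeDivisor A) : IsDiscreteKValuation (gr F K) (mu φ p) where
  map_mul x y z hxyz := by
    obtain rfl : z = x * y := Homog.ext hxyz
    obtain ⟨a, v, rfl⟩ := exists_eq_monomial x
    obtain ⟨b, w, rfl⟩ := exists_eq_monomial y
    rw [monomial_mul, mu_monomial, mu_monomial, mu_monomial, map_add, h.value_add, (h.disc p).mul]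
    ring
  surjective n := by
    obtain ⟨a, ha⟩ := (h.disc p).surjective n
    exact ⟨monomial a 0, by rw [mu_monomial_zero h, ha]⟩
  min_le_add w x y z hx hy hxyz := by
    have hz : z.val ∈ gr F K w := hxyz ▸ add_mem hx hy
    obtain ⟨a, rfl⟩ := exists_eq_monomial_of_mem hx
    obtain ⟨b, rfl⟩ := exists_eq_monomial_of_mem hy
    obtain ⟨c, rfl⟩ := exists_eq_monomial_of_mem hz
    have hc : c.val = a.val + b.val := by
      have := congrArg (fun t => t.coeff w) hxyz
      simpa using this
    have := (h.disc p).min_le_add () a b c (AddSubgroup.mem_top _) (AddSubgroup.mem_top _) hc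
    rw [mu_monomial, mu_monomial, mu_monomial]
    omega

theorem finite_mu_ne_zero (h : HasEssentialFamily A F)
    (f : Homog (gr F K)) : {p | mu φ p f ≠ 0}.Finite := by
  obtain ⟨a, w, rfl⟩ := exists_eq_monomial f
  refine ((h.finite_ne_zero a).union (h.finite_value_ne_zero (φ w))).subset fun p hp => ?_
  by_contra hc
  simp only [Set.mem_union, Set.mem_ofPred_eq, not_or, not_not] at hc hp
  rw [mu_monomial] at hp
  omega

/-- Degree zero suffices: `μ_p` agrees with `ν_p` there, so separating elements of `A` serve for
`R`, and a denominator of any `f` exists in degree zero by bounding its finitely many poles. -/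
theorem isEssentialFamily_mu (h : HasEssentialFamily A F) :
    IsEssentialFamily (divRing φ) (mu φ) := by
  have hint : ∀ f : Homog (gr F K), f.IsIntegral (divRing φ) ↔ ∀ p, 0 ≤ mu φ p f := fun f => by
    rw [isIntegral_divRing_iff, divRing, Subring.mem_iInf]
    exact forall_congr' fun p => Homog.mem_kValuationRing (isDiscreteKValuation_mu h p)
  refine ⟨⟨isDiscreteKValuation_mu h, hint, fun f _ => finite_mu_ne_zero h f, fun f => ?_⟩,
    fun p => ?_⟩
  · let n : PrimeDivisor A →₀ ℤ := Finsupp.ofSupportFinite (fun p => max 0 (-mu φ p f))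
      ((finite_mu_ne_zero h f).subset fun j hj hj0 => hj (by simp only; rw [hj0]; rfl))
    obtain ⟨b, hb⟩ := h.exists_mem_divisorial n
    change ∀ p, max 0 (-mu φ p f) ≤ essVal F p b at hb
    refine ⟨monomial b 0, (hint _).2 fun p => ?_, (hint _).2 fun p => ?_⟩
    · have := hb p
      rw [mu_monomial_zero h]
      omega
    · have := hb p
      rw [(isDiscreteKValuation_mu h p).mul, mu_monomial_zero h]
      omega
  · obtain ⟨z, hz, hz'⟩ := h.exists_sep p
    exact ⟨monomial z 0, by rw [mu_monomial_zero h, hz], fun q hq => by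
      rw [mu_monomial_zero h]
      exact hz' q hq⟩

theorem single_zero_mem_atLeast_iff (h : HasEssentialFamily A F)
    (p : PrimeDivisor A) (n : ℤ) (y : F) :
    single (0 : K) y ∈ atLeastCarrier (mu φ p) n ↔ y ∈ atLeastCarrier (essVal F p) n := by
  by_cases hy : y = 0
  · rw [hy, single_zero]
    simp only [zero_mem_atLeastCarrier]
  · let a : Homog (trivialGrading F) := ⟨y, hy, isHomogeneousElem_trivialGrading y⟩
    have h1 := Homog.mem_atLeastCarrier (ν := mu φ p) (n := n) (f := monomial a (0 : K))
    rw [mu_monomial_zero h, ← Homog.mem_atLeastCarrier] at h1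
    exact h1

/-- There are units of value zero in every degree of the valuation ring of `μ_p`. -/
theorem exists_mu_eq_zero (h : HasEssentialFamily A F)
    (p : PrimeDivisor A) (w : K) : ∃ a, mu φ p (monomial a w) = 0 := by
  obtain ⟨a, ha⟩ := (h.disc p).surjective (-(φ w).value (essVal F p))
  exact ⟨a, by rw [mu_monomial, ha, neg_add_cancel]⟩

/-- An element `a` with `ν_p(a) ≥ -ν_p(φ w)` for all `p` exists because the divisorial module of `-φ
w` is non-zero. -/
theorem exists_monomial_mem_divRing (h : HasEssentialFamily A F) (w : K) :
    ∃ a, (monomial a w).val ∈ divRing φ := by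
  obtain ⟨a, ha⟩ := h.exists_mem_divisorial (-h.divEquiv.symm (φ w))
  refine ⟨a, (isIntegral_divRing_iff φ).1 (((isEssentialFamily_mu h).integral_iff _).2 fun p => ?_)⟩
  have := ha p
  rw [Finsupp.neg_apply, ← h.value_eq] at this
  rw [mu_monomial]
  omega

theorem single_zero_mem_divRing_iff (h : HasEssentialFamily A F) (y : F) :
    single (0 : K) y ∈ divRing φ ↔ y ∈ (algebraMap A F).range := by
  rw [h.isDefiningFamily.range_eq, divRing]
  simp only [Subring.mem_iInf, Set.forall_mem_range]
  refine forall_congr' fun p => ?_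
  rw [mem_kValuationRing_iff (hν := isDiscreteKValuation_mu h p),
    mem_kValuationRing_iff (hν := h.disc p)]
  exact single_zero_mem_atLeast_iff h p 0 y

theorem mem_grade_zero_iff {x : AddMonoidAlgebra F K} :
    x ∈ gr F K 0 ↔ ∃ y, x = single 0 y :=
  ⟨fun hx => ⟨_, eq_single_of_mem_grade hx⟩, fun ⟨y, hy⟩ => hy ▸ single_mem_grade 0 y⟩

theorem algebraMap_eq_single (a : A) :
    algebraMap A (AddMonoidAlgebra F K) a = single 0 (algebraMap A F a) := by
  rw [coe_algebraMap]
  rfl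

theorem degree_zero_divRing (h : HasEssentialFamily A F)
    (x : AddMonoidAlgebra F K) :
    x ∈ divRing φ ∧ x ∈ gr F K 0 ↔ ∃ a : A, x = algebraMap A (AddMonoidAlgebra F K) a := by
  rw [mem_grade_zero_iff]
  constructor
  · rintro ⟨hx, y, rfl⟩
    obtain ⟨a, rfl⟩ := (single_zero_mem_divRing_iff h y).1 hx
    exact ⟨a, (algebraMap_eq_single a).symm⟩
  · rintro ⟨a, rfl⟩
    rw [algebraMap_eq_single]
    exact ⟨(single_zero_mem_divRing_iff h _).2 ⟨a, rfl⟩, _, rfl⟩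

/-- The isomorphism of `Div^K(R)` with `Div(A)`. -/
def divIso (h : HasEssentialFamily A F) :
    DivR φ ≃+o Div A F :=
  (isEssentialFamily_mu h).divEquiv.symm.trans h.divEquiv

theorem value_divIso (h : HasEssentialFamily A F)
    (b : DivR φ) (p : PrimeDivisor A) :
    (divIso h b).value (essVal F p) = b.value (mu φ p) := by
  rw [(isEssentialFamily_mu h).value_eq]
  exact h.value_divEquiv _ p

theorem divIso_principalDiv (h : HasEssentialFamily A F)
    (a : Homog (trivialGrading F)) (w : K) :
    divIso h (principalDiv (gr F K) (divRing φ) (monomial a w)) =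
      principalDiv (trivialGrading F) A a + φ w := by
  refine h.eq_of_value_eq fun p => ?_
  rw [value_divIso h, (isEssentialFamily_mu h).value_principalDiv, mu_monomial, h.value_add,
    h.value_principalDiv]

theorem principalDiv_one {K S σ : Type*} [AddCommGroup K] [DecidableEq K] [CommRing S]
    [SetLike σ S] [AddSubgroupClass σ S] {𝒮 : K → σ} [GradedRing 𝒮] [KSimple 𝒮]
    {R : Type*} [CommRing R] [Algebra R S] [IsGradedSubring 𝒮 R] :
    principalDiv 𝒮 R 1 = 0 :=
  KDiv.ext Submodule.one_eq_span.symm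

/-- The least values on `a` are attained at every `p`, and they are unchanged on passing to degree
zero of `F[K]`; the span therefore has the divisorial hull with the same coefficients. -/
theorem carrier_divIso_symm (h : HasEssentialFamily A F)
    (a : Div A F) : ((divIso h).symm a : DivR φ).carrier =
      1 / (1 / Submodule.span (divRing φ) ((fun f : F => single (0 : K) f) '' a.carrier)) := by
  obtain ⟨n, rfl⟩ : ∃ n, a = h.divEquiv n :=
    ⟨h.divEquiv.symm a, (h.divEquiv.apply_symm_apply a).symm⟩
  have h1 : (divIso h).symm (h.divEquiv n) = (isEssentialFamily_mu (φ := φ) h).divEquiv n :=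
    congrArg (isEssentialFamily_mu (φ := φ) h).divEquiv (h.divEquiv.symm_apply_apply n)
  rw [h1]
  refine ((isEssentialFamily_mu h).div_div_eq (Submodule.span_le.2 ?_) fun p => ?_).symm
  · rintro _ ⟨y, hy, rfl⟩ p
    exact (single_zero_mem_atLeast_iff h p (n p) y).2 (hy p)
  · obtain ⟨f, hf, hf'⟩ := h.exists_approx n p
    exact ⟨monomial f 0, Submodule.subset_span ⟨f.val, h.val_mem_divisorial.2 hf', rfl⟩,
      by rw [mu_monomial_zero h, hf]⟩

/-- Since `div(a χ^w)` corresponds to `div a + φ w`, killing principal divisors of `R` kills those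
of `A` (take `w = 0`) and the image of `φ` (take `a = 1`), and nothing more. -/
theorem exists_class_equiv (h : HasEssentialFamily A F) :
    ∃ γ : KCl (gr F K) (divRing φ) ≃+ ClModImage φ, ∀ b : DivR φ,
      γ (KCl.mk (gr F K) b) = (KCl.mk (trivialGrading F) (divIso h b) : ClModImage φ) := by
  refine exists_quotient_equiv (divIso (φ := φ) h).toAddEquiv ?_ ?_ ?_
  · rintro _ ⟨f, rfl⟩
    obtain ⟨a, w, rfl⟩ := exists_eq_monomial f
    change ((((divIso h _ : Div A F) : Cl A F)) : ClModImage φ) = 0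
    rw [divIso_principalDiv, AddCon.coe_add, mk_quotientCon_eq_zero (Set.mem_range_self a),
      zero_add]
    exact mk_quotientCon_eq_zero ⟨w, rfl⟩
  · rintro _ ⟨a, rfl⟩
    refine mk_quotientCon_eq_zero ⟨monomial a 0, ?_⟩
    refine (AddEquiv.eq_symm_apply _).2 ?_
    change divIso h _ = _
    rw [divIso_principalDiv, map_zero, add_zero]
  · rintro _ ⟨w, rfl⟩
    refine ⟨φ w, rfl, mk_quotientCon_eq_zero ⟨monomial 1 w, ?_⟩⟩
    refine (AddEquiv.eq_symm_apply _).2 ?_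
    change divIso h _ = _
    rw [divIso_principalDiv, principalDiv_one, zero_add]

end Divisorial

end KKrull

end

/-! ### The main theorem. -/

open AddMonoidAlgebra KKrull in
theorem mainTheorem7 {A F K : Type*} [CommRing A] [IsDomain A] [Field F] [Algebra A F]
    [IsFractionRing A F] [AddCommGroup K] [DecidableEq K] (hA : IsKrullRing A F)
    (φ : K →+ Div A F) :
    -- (i) `R₀ = A`, and `F[K]` is the homogeneous fraction ring of `R`
    (∀ x : AddMonoidAlgebra F K, x ∈ divRing φ ∧ x ∈ gr F K 0 ↔
      ∃ a : A, x = algebraMap A (AddMonoidAlgebra F K) a) ∧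
    IsLocalization (homogSubmonoid (gr F K) (divRing φ)) (AddMonoidAlgebra F K) ∧
    -- (ii) the `μ_p` are the minimal family of valuations defining `R`
    IsLeast {V | IsDefiningFamily (gr F K) (divRing φ) V} (Set.range (mu φ)) ∧
    -- (`K`-)prime divisors `p` and `q`, regarded as divisors `P p` and `Q q`; the isomorphism `α`
    -- of divisor groups and the bijection `E` of prime divisors
    (∃ (P : PrimeDivisor A → Div A F) (Q : PrimeDivR φ → DivR φ) (α : DivR φ ≃+o Div A F)
      (E : PrimeDivR φ ≃ PrimeDivisor A),
      (∀ p, (P p).carrier = Submodule.map (Algebra.linearMap A F) p.ideal) ∧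
      (∀ q, (Q q).carrier =
        Submodule.map (Algebra.linearMap (divRing φ) (AddMonoidAlgebra F K)) q.ideal) ∧
      (∀ b : DivR φ, {p | b.value (mu φ p) ≠ 0}.Finite ∧
        α b = ∑ᶠ p, b.value (mu φ p) • P p) ∧
      (∀ a : Div A F, (α.symm a).carrier =
        1 / (1 / Submodule.span (divRing φ) ((fun f : F => single (0 : K) f) '' a.carrier))) ∧
      (∀ q, α (Q q) = P (E q)) ∧
      (∀ q (a : A), a ∈ (E q).ideal ↔
        ∃ r ∈ q.ideal, (r : AddMonoidAlgebra F K) = algebraMap A (AddMonoidAlgebra F K) a) ∧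
      (∀ p, (E.symm p).ideal =
        Ideal.span {r : divRing φ | ∃ f : Homog (gr F K), f.val = r ∧ 0 < mu φ p f}) ∧
      -- `μ_p` is the essential valuation at the `K`-prime divisor `q` over `p`: it has valuation
      -- ring `R_q` and its values are the coefficients of `q` in principal divisors
      (∀ q, kValuationRing (gr F K) (mu φ (E q)) = locR φ q) ∧
      (∀ f : Homog (gr F K), {q | mu φ (E q) f ≠ 0}.Finite ∧
        principalDiv (gr F K) (divRing φ) f = ∑ᶠ q, mu φ (E q) f • Q q) ∧
      -- the induced isomorphism `Cl^K(R) ≅ Cl(A) / im(φ̄)`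
      (∃ γ : KCl (gr F K) (divRing φ) ≃+ ClModImage φ,
        ∀ b : DivR φ, γ (KCl.mk (gr F K) b) =
          (KCl.mk (trivialGrading F) (α b) : ClModImage φ)) ∧
      -- (iii) `R_q` has units in every degree, and `(R_q)₀ = A_p` for `p = q ∩ A`
      (∀ q, (∀ w : K, ∃ u : (locR φ q)ˣ, ((u : locR φ q) : AddMonoidAlgebra F K) ∈ gr F K w) ∧
        ∀ x : AddMonoidAlgebra F K,
          x ∈ locR φ q ∧ x ∈ gr F K 0 ↔ ∃ y ∈ primeLoc F (E q), x = single 0 y)) ∧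
    -- (iv) `deg_K(R⁺) = K`
    {w : K | ∃ r ∈ divRing φ, r ≠ 0 ∧ r ∈ gr F K w} = Set.univ := by
  obtain ⟨h, hc⟩ := hA.exists_essentialFamily
  have hR := isEssentialFamily_mu (φ := φ) h
  have hinj := divRing_injective φ
  let E : PrimeDivR φ ≃ PrimeDivisor A := (hR.centerEquiv hinj).symm
  have hE : ∀ q, q.ideal = hR.center (E q) := fun q => by
    rw [← hR.ideal_centerEquiv hinj, Equiv.apply_symm_apply]
  have hloc : ∀ q, kValuationRing (gr F K) (mu φ (E q)) = locR φ q := fun q =>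
    hR.kValuationRing_eq (E q) _ (hE q)
  refine ⟨degree_zero_divRing h, hR.isLocalization hinj, hR.isLeast,
    ⟨fun p => h.divEquiv (Finsupp.single p 1), fun q => hR.divEquiv (Finsupp.single (E q) 1),
      divIso h, E, fun p => ?_, fun q => ?_, fun b => ⟨hR.finite_value_ne_zero b, ?_⟩,
      carrier_divIso_symm h, fun q => ?_, fun q a => ?_, fun p => ?_, fun q => ?_,
      fun f => ⟨?_, ?_⟩, exists_class_equiv h, fun q => ⟨fun w => ?_, fun x => ?_⟩⟩, ?_⟩
  · rw [← hc, h.map_center]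
    rfl
  · rw [hE, hR.map_center]
    rfl
  · simp only [← value_divIso h]
    exact h.eq_finsum (divIso h b)
  -- Both prime divisors come from the same basis vector `Finsupp.single (E q) 1`.
  · exact congrArg h.divEquiv (hR.divEquiv.symm_apply_apply _)
  · rw [← hc, h.mem_center, ← single_zero_mem_atLeast_iff (φ := φ) h, ← algebraMap_eq_single,
      hE]
    constructor
    · intro ha
      refine ⟨⟨_, ((degree_zero_divRing h _).2 ⟨a, rfl⟩).1⟩, hR.mem_center.2 ha, rfl⟩
    · rintro ⟨r, hr, hra⟩
      rw [← hra]
      exact hR.mem_center.1 hr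
  · exact hR.center_eq_span hinj p
  · exact hloc q
  · exact (hR.finite_ne_zero f).preimage E.injective.injOn
  · have h1 := hR.eq_finsum (principalDiv (gr F K) (divRing φ) f)
    simp only [hR.value_principalDiv] at h1
    rw [← finsum_comp_equiv E] at h1
    exact h1
  · obtain ⟨a, ha⟩ := exists_mu_eq_zero (φ := φ) h (E q) w
    have hmem : ∀ f : Homog (gr F K), mu φ (E q) f = 0 → f.val ∈ locR φ q := fun f hf => by
      rw [← hloc]
      exact (Homog.mem_kValuationRing (hR.disc _)).2 hf.ge
    -- A homogeneous element of value zero and its inverse both lie in the valuation ring, which is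
    -- `R_q`.
    refine ⟨⟨⟨_, hmem _ ha⟩, ⟨_, hmem (monomial a w)⁻¹ (by rw [(hR.disc _).inv, ha, neg_zero])⟩,
      Subtype.ext (Homog.val_mul_inv _), Subtype.ext (Homog.val_inv_mul _)⟩, ?_⟩
    exact single_mem_grade w a.val
  · have h1 : ∀ y, y ∈ primeLoc F (E q) ↔ single 0 y ∈ locR φ q := fun y => by
      rw [← hloc, primeLoc,
        ← h.kValuationRing_eq (E q) _ (hc (E q)).symm, mem_kValuationRing_iff (hν := h.disc _),
        mem_kValuationRing_iff (hν := hR.disc _)]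
      exact (single_zero_mem_atLeast_iff h (E q) 0 y).symm
    rw [mem_grade_zero_iff]
    constructor
    · rintro ⟨hx, y, rfl⟩
      exact ⟨y, (h1 y).2 hx, rfl⟩
    · rintro ⟨y, hy, rfl⟩
      exact ⟨(h1 y).1 hy, y, rfl⟩
  · refine Set.eq_univ_of_forall fun w => ?_
    obtain ⟨a, ha⟩ := exists_monomial_mem_divRing (φ := φ) h w
    exact ⟨_, ha, (monomial a w).ne_zero, single_mem_grade w a.val⟩
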